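/- Let $U\subset\mathbb C^n$ be a complete pseudoconvex Reinhardt domain (possibly $U=\mathbb C^n$), write $\|z\|=(|z_1|^2+\cdots+|z_n|^2)^{1/2}$, $D(R)=\{z\in\mathbb C^n:\|z\|<R\}$, $D_{\mathbb R}(R)=\{x\in\mathbb R^n:\|x\|<R\}$, and let $F:U\to\mathbb R$ be a $C^\infty$ function such that (A) $F(z)=0$ if and only if $z=0$, and $F$ is not flat at the origin (its Taylor series at $0$ is not identically zero); (B) $F$ is plurisubharmonic on $U$; (C) $F(e^{i\theta_1}z_1,\ldots,e^{i\theta_n}z_n)=F(z_1,\ldots,z_n)$ for all $\theta_j\in\mathbb R$ and $z\in U$; (D) if $U$ is unbounded, then there are $c,\beta,L>0$ such that $F(z)\ge c\|z\|^\beta$ for all $z\in U\setminus D(L)$. Let $\Omega_F=\{(z_0,z)\in\mathbb C\times U:\operatorname{Im} z_0>F(z)\}$, let $B_{\Omega_F}$ be its Bergman kernel on the diagonal (the reproducing kernel of the space of holomorphic functions on $\Omega_F$ that are square integrable with respect to Lebesgue measure), and set $\mathcal B_F(\rho)=B_{\Omega_F}(i\rho,0,\ldots,0)$ for $\rho>0$.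 Let $R>0$ be such that $D(R)\subset U$, let $\varphi:\mathbb R^n\to[0,1]$ be a $C^\infty$ function with $\varphi=1$ on $D_{\mathbb R}(R/2)$ and with support contained in $D_{\mathbb R}(R)$, put $\Phi(z)=\varphi(|z_1|,\ldots,|z_n|)$, and, with $dV$ the Lebesgue measure, define $$\tilde{\mathcal B}_F(\rho)=\frac1\pi\int_0^\infty e^{-2\rho\tau}\,\frac{\tau}{\tilde c_0(\tau)^2}\,d\tau\quad(\rho>0),\qquad \tilde c_0(\tau)^2=\int_U e^{-2\tau F(z)}\,\Phi(z)\,dV(z).$$ Then $\tilde c_0(\tau)^2>0$ for all $\tau>0$, the integral $\tilde{\mathcal B}_F(\rho)$ converges and the kernel $\mathcal B_F(\rho)$ exists for every $\rho>0$, and the difference $\tilde{\mathcal B}_F(\rho)-\mathcal B_F(\rho)$ extends from $(0,\infty)$ real-analytically to an open neighborhood of $\rho=0$: there are $\delta>0$ and a real-analytic function $g$ on $(-\delta,\infty)$ with $g(\rho)=\tilde{\mathcal B}_F(\rho)-\mathcal B_F(\rho)$ for all $\rho>0$. (In this sense $\tilde{\mathcal B}_F$ and $\mathcal B_F$ have the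 same singularity at $0$.) -/

import Mathlib

open MeasureTheory Set
open scoped ContDiff

noncomputable section

namespace BergmanModel

/-- The Euclidean norm `‖z‖ = (|z₁|² + ⋯ + |zₙ|²)^{1/2}` on `ℝⁿ` or `ℂⁿ`
(the norm that Lean puts on a function space is the sup norm). -/
def euclNorm {K : Type*} [Norm K] {n : ℕ} (z : Fin n → K) : ℝ :=
  √(∑ j, ‖z j‖ ^ 2)

/-- The open Euclidean ball of radius `R` about the origin of `ℝⁿ` or `ℂⁿ`. -/
def euclBall (K : Type*) [Norm K] (n : ℕ) (R : ℝ) : Set (Fin n → K) :=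
  {z | euclNorm z < R}

/-- A continuous plurisubharmonic function on the open set `U`: the sub-mean value inequality
holds on the boundary circle of every closed (affine) complex disc contained in `U`. -/
def IsContPSHOn {E : Type*} [NormedAddCommGroup E] [NormedSpace ℂ E]
    (u : E → ℝ) (U : Set E) : Prop :=
  ContinuousOn u U ∧
    ∀ z ∈ U, ∀ w : E, (∀ ζ : ℂ, ‖ζ‖ ≤ 1 → z + ζ • w ∈ U) →
      u z ≤ Real.circleAverage (fun ζ : ℂ => u (z + ζ • w)) 0 1

/-- Pseudoconvexity of an open set: there is a continuous plurisubharmonic exhaustion function. -/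
def IsPseudoconvex {E : Type*} [NormedAddCommGroup E] [NormedSpace ℂ E] (U : Set E) : Prop :=
  ∃ u : E → ℝ, IsContPSHOn u U ∧ ∀ c : ℝ, IsCompact {z | z ∈ U ∧ u z ≤ c}

/-- A complete Reinhardt domain in `ℂⁿ`: a nonempty open set which with a point `z` contains the
closed polydisc of all `w` with `|wⱼ| ≤ |zⱼ|` (connectedness is automatic, as such a set is
star-shaped about the origin). -/
structure IsCompleteReinhardtDomain {n : ℕ} (U : Set (Fin n → ℂ)) : Prop where
  isOpen : IsOpen U
  nonempty : U.Nonempty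
  complete : ∀ z ∈ U, ∀ w : Fin n → ℂ, (∀ j, ‖w j‖ ≤ ‖z j‖) → w ∈ U

/-- `F` is flat at the origin: its Taylor series there vanishes. -/
def IsFlatAtZero {n : ℕ} (F : (Fin n → ℂ) → ℝ) : Prop :=
  ∀ k : ℕ, iteratedFDeriv ℝ k F 0 = 0

/-- The conditions (A), (B), (C), (D) on a function `F` on `U`. -/
structure SatisfiesABCD {n : ℕ} (U : Set (Fin n → ℂ)) (F : (Fin n → ℂ) → ℝ) : Prop where
  zero_iff : ∀ z ∈ U, (F z = 0 ↔ z = 0)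
  not_flat : ¬ IsFlatAtZero F
  psh : IsContPSHOn F U
  rotation_invariant : ∀ z ∈ U, ∀ θ : Fin n → ℝ,
    F (fun j => Complex.exp (Complex.I * θ j) * z j) = F z
  growth : ¬ Bornology.IsBounded U →
    ∃ c β L : ℝ, 0 < c ∧ 0 < β ∧ 0 < L ∧
      ∀ z ∈ U \ euclBall ℂ n L, c * euclNorm z ^ β ≤ F z

/-- The model domain `Ω_F = {(z₀, z) ∈ ℂ × U : Im z₀ > F(z)}`. -/
def modelDomain {n : ℕ} (U : Set (Fin n → ℂ)) (F : (Fin n → ℂ) → ℝ) :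
    Set (ℂ × (Fin n → ℂ)) :=
  {p | p.2 ∈ U ∧ F p.2 < p.1.im}

/-- `f` belongs to `A²(Ω)`, the space of holomorphic functions on `Ω` that are square integrable
with respect to Lebesgue measure. -/
def IsBergmanFunction {E : Type*} [NormedAddCommGroup E] [NormedSpace ℂ E] [MeasureSpace E]
    (Ω : Set E) (f : E → ℂ) : Prop :=
  DifferentiableOn ℂ f Ω ∧ MemLp f 2 (volume.restrict Ω)

/-- `k` is the Bergman kernel function `B_Ω(·, w)` with pole `w`: the element of `A²(Ω)` with
`f(w) = ⟨f, k⟩` for all `f ∈ A²(Ω)`. Its values on `Ω` are uniquely determined. -/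
def IsBergmanKernelAt {E : Type*} [NormedAddCommGroup E] [NormedSpace ℂ E] [MeasureSpace E]
    (Ω : Set E) (w : E) (k : E → ℂ) : Prop :=
  IsBergmanFunction Ω k ∧
    ∀ f : E → ℂ, IsBergmanFunction Ω f → f w = ∫ z in Ω, f z * (starRingEnd ℂ) (k z)

open Classical in
/-- The Bergman kernel `B_Ω(z, w)` of `Ω`. -/
def bergmanKernel {E : Type*} [NormedAddCommGroup E] [NormedSpace ℂ E] [MeasureSpace E]
    (Ω : Set E) (z w : E) : ℂ :=
  if h : ∃ k : E → ℂ, IsBergmanKernelAt Ω w k then h.choose z else 0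

/-- `𝓑_F(ρ) = B_{Ω_F}(iρ, 0, …, 0)`, the Bergman kernel of `Ω_F` on the diagonal (a real number),
restricted to the vertical line over the origin. -/
def bergmanVertical {n : ℕ} (U : Set (Fin n → ℂ)) (F : (Fin n → ℂ) → ℝ) (ρ : ℝ) : ℝ :=
  (bergmanKernel (modelDomain U F) (Complex.I * ρ, 0) (Complex.I * ρ, 0)).re

/-- `Φ(z₁, …, zₙ) = φ(|z₁|, …, |zₙ|)`. -/
def polarLift {n : ℕ} (φ : (Fin n → ℝ) → ℝ) (z : Fin n → ℂ) : ℝ :=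
  φ (fun j => ‖z j‖)

/-- `φ` is an admissible cut-off function on `ℝⁿ` for the radius `R`. -/
structure IsCutoff {n : ℕ} (R : ℝ) (φ : (Fin n → ℝ) → ℝ) : Prop where
  smooth : ContDiff ℝ ∞ φ
  mem_Icc : ∀ x, φ x ∈ Icc (0 : ℝ) 1
  eq_one : ∀ x ∈ euclBall ℝ n (R / 2), φ x = 1
  support : tsupport φ ⊆ euclBall ℝ n R

/-- `c̃₀(τ)² = ∫_U e^{-2τF(z)} Φ(z) dV(z)`. -/
def cTildeSq {n : ℕ} (U : Set (Fin n → ℂ)) (F : (Fin n → ℂ) → ℝ) (φ : (Fin n → ℝ) → ℝ)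
    (τ : ℝ) : ℝ :=
  ∫ z in U, Real.exp (-2 * τ * F z) * polarLift φ z

/-- The localized integral `(1/π) ∫₀^∞ e^{-2ρτ} τ / c̃₀(τ)² dτ`. The factor `1/π` is the one for
which the same integral with `c₀(τ)² = ∫_U e^{-2τF} dV` in place of `c̃₀(τ)²` is the Bergman
kernel of `Ω_F` with respect to Lebesgue measure (for a half plane that kernel is
`1/(4πρ²) = (1/π) ∫₀^∞ e^{-2ρτ} τ dτ`). -/
def localizedBergman {n : ℕ} (U : Set (Fin n → ℂ)) (F : (Fin n → ℂ) → ℝ)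
    (φ : (Fin n → ℝ) → ℝ) (ρ : ℝ) : ℝ :=
  1 / Real.pi * ∫ τ in Ioi (0 : ℝ), Real.exp (-2 * ρ * τ) * (τ / cTildeSq U F φ τ)

end BergmanModel

end

noncomputable section

namespace BergmanModel

open Filter Topology Complex

/-! ### Auxiliary analysis -/

/-! On the vertical line over the origin the Bergman kernel is itself a Laplace integral, $\mathcal
B_F(\rho)=\frac1\pi\int_0^\infty e^{-2\rho\tau}\,\tau\,c_0(\tau)^{-2}d\tau$ with $c_0(\tau)^2=\int_U
e^{-2\tau F}dV$ (`SatisfiesABCD.bergmanVertical_eq`). Hence the difference in question is the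
Laplace transform of $w=\tau/\tilde c_0^2-\tau/c_0^2\ge0$. By the maximum principle along rays and
compactness of a sphere, $F\ge m>0$ off $D(R/2)$, so $c_0^2-\tilde c_0^2=O(e^{-2m\tau})$ for
$\tau\ge1$. Since $F$ is continuous with $F(0)=0$, both $c_0^2$ and $\tilde c_0^2$ exceed a multiple
of $e^{-\eta\tau}$ for every $\eta>0$. Therefore $w=O(e^{-m\tau})$
(`SatisfiesABCD.exists_difference_le`), and its transform is analytic for $2\rho>-m$.

The formula for the kernel is obtained by writing down a candidate and verifying the reproducing
property. Averaging $f\in A^2(\Omega_F)$ over the rotations $z\mapsto e^{i\theta}z$ replaces it by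
$f(z_0,0)$; this does not increase the norm and does not change the pairing with a function of $z_0$
alone. Integrating out $z$ turns Lebesgue measure on $\Omega_F$ into $dx\otimes\Lambda$ on the upper
half plane, where $\Lambda$ has density $\mathrm{vol}\{F<y\}$
(`SatisfiesABCD.measurePreserving_re_im`). What remains is a weighted Bergman space of one variable
with kernel $\frac1{2\pi}\int_0^\infty e^{i(z-\bar w)\tau}A(\tau)^{-1}d\tau$, $A(\tau)=\int
e^{-2\tau y}d\Lambda(y)$.

For functions that are holomorphic across the real line and decay, the reproducing property follows
from Fubini, a shift of horizontal lines and Cauchy's formula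
(`IsHalfPlaneWeight.integral_mul_conj_kernel_of_decay`). A general function is approximated by
damped upward translates, which converge pointwise with norms bounded by that of the limit, hence
weakly (`IsHalfPlaneWeight.integral_mul_conj_kernel`). -/

/-- The integrals of a holomorphic function over two horizontal lines agree if the function decays
at the ends of the strip between them. -/
lemma integral_horizontal_line_eq {q : ℂ → ℂ} {Y C X₀ : ℝ} (hY : 0 ≤ Y)
    (hd : DifferentiableOn ℂ q {z | 0 ≤ z.im})
    (hb : ∀ x y : ℝ, X₀ ≤ |x| → 0 ≤ y → y ≤ Y → ‖q (x + y * I)‖ ≤ C / x ^ 2)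
    (h0 : Integrable fun x : ℝ => q x) (h1 : Integrable fun x : ℝ => q (x + Y * I)) :
    ∫ x : ℝ, q (x + Y * I) = ∫ x : ℝ, q x := by
  have t0 := intervalIntegral_tendsto_integral h0 tendsto_neg_atTop_atBot tendsto_id
  have t1 := intervalIntegral_tendsto_integral h1 tendsto_neg_atTop_atBot tendsto_id
  have key : Tendsto (fun T : ℝ => (∫ x in -T..id T, q x) - ∫ x in -T..id T, q (x + Y * I))
      atTop (𝓝 0) := by
    have hC : Tendsto (fun T : ℝ => 2 * (C / T ^ 2 * |Y - 0|)) atTop (𝓝 0) := by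
      have : Tendsto (fun T : ℝ => C / T ^ 2) atTop (𝓝 0) :=
        Tendsto.const_div_atTop (tendsto_pow_atTop two_ne_zero) C
      simpa using (this.mul_const |Y - 0|).const_mul 2
    refine squeeze_zero_norm' ?_ hC
    filter_upwards [eventually_ge_atTop (max X₀ 0)] with T hT
    have hT0 : X₀ ≤ |T| := (le_max_left _ _).trans (hT.trans (le_abs_self T))
    have hrect := Complex.integral_boundary_rect_eq_zero_of_differentiableOn q (-T : ℂ)
      (T + Y * I) (hd.mono ?_)
    · simp only [neg_re, ofReal_re, add_re, mul_re, I_re, mul_zero, ofReal_im, I_im, mul_one,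
        sub_self, add_zero, neg_im, neg_zero, ofReal_zero, zero_mul, add_im, mul_im, zero_add,
        smul_eq_mul, ofReal_neg] at hrect
      have e : (∫ x in -T..id T, q x) - ∫ x in -T..id T, q (x + Y * I)
          = I * (∫ y in (0 : ℝ)..Y, q (-T + y * I)) - I * ∫ y in (0 : ℝ)..Y, q (T + y * I) := by
        simp only [id]
        linear_combination hrect
      rw [e]
      have hs : ∀ S : ℝ, X₀ ≤ |S| → S ^ 2 = T ^ 2 →
          ‖∫ y in (0 : ℝ)..Y, q (S + y * I)‖ ≤ C / T ^ 2 * |Y - 0| := by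
        intro S hS hST
        refine intervalIntegral.norm_integral_le_of_norm_le_const fun y hy => ?_
        rw [uIoc_of_le hY] at hy
        rw [← hST]
        exact hb S y hS hy.1.le hy.2
      have a1 := hs T hT0 rfl
      have a2 := hs (-T) (by rwa [abs_neg]) (by ring)
      rw [ofReal_neg] at a2
      refine (norm_sub_le _ _).trans ?_
      rw [norm_mul, norm_mul, norm_I, one_mul, one_mul]
      linarith
    · intro z hz
      have := hz.2
      simp only [neg_im, ofReal_im, neg_zero, add_im, mul_im, ofReal_re, I_im, mul_one, I_re,
        mul_zero, add_zero, zero_add, uIcc_of_le hY, mem_preimage] at this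
      exact this.1
  have := tendsto_nhds_unique key (t0.sub t1)
  exact (sub_eq_zero.1 this.symm).symm

lemma integrable_inv_one_add_sq_scaled {ρ : ℝ} (hρ : 0 < ρ) :
    Integrable (fun x : ℝ => (x ^ 2 + ρ ^ 2)⁻¹) ∧ ∫ x : ℝ, (x ^ 2 + ρ ^ 2)⁻¹ = Real.pi / ρ := by
  have e : (fun x : ℝ => (x ^ 2 + ρ ^ 2)⁻¹) = fun x => (ρ ^ 2)⁻¹ * (1 + (x / ρ) ^ 2)⁻¹ := by
    ext x
    rw [← mul_inv]
    congr 1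
    field_simp
    ring
  constructor
  · rw [e]
    exact (integrable_inv_one_add_sq.comp_div hρ.ne').const_mul _
  · rw [e, integral_const_mul, Measure.integral_comp_div (fun x : ℝ => (1 + x ^ 2)⁻¹) ρ,
      integral_univ_inv_one_add_sq, abs_of_pos hρ, smul_eq_mul]
    field_simp

/-- Cauchy's formula in the upper half plane. -/
lemma integral_div_sub_eq_of_decay {h : ℂ → ℂ} {a C ρ : ℝ} (ha : 0 < a) (hρ : 0 < ρ)
    (hd : DifferentiableOn ℂ h {z | -a < z.im})
    (hb : ∀ x y : ℝ, 0 ≤ y → ‖h (x + y * I)‖ ≤ C * ((1 + x ^ 2)⁻¹ * (1 + y)⁻¹)) :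
    ∫ x : ℝ, h x / (ρ + I * x) = 2 * Real.pi * h (I * ρ) := by
  have hC : 0 ≤ C := by
    have := (norm_nonneg _).trans (hb 0 0 le_rfl)
    simpa using this
  set c : ℂ := I * ρ with hc
  have hcim : c.im = ρ := by simp [hc]
  -- Both `h` and `1 / (z + c)` are holomorphic for `Im z > -b`.
  set b : ℝ := min a ρ with hbdef
  have hb0 : 0 < b := lt_min ha hρ
  have hV : IsOpen {z : ℂ | -b < z.im} := isOpen_lt continuous_const continuous_im
  -- The subtracted term has its only pole at `-c`, in the lower half plane, and takes the value `h
  -- c` at `c`. So `H / (z - c)` is holomorphic up to the real line and gains one more order of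
  -- decay.
  set H : ℂ → ℂ := fun z => h z - h c * (2 * c) / (z + c) with hH
  have hzc : ∀ z : ℂ, -b < z.im → z + c ≠ 0 := by
    intro z hz h0
    have h1 := congrArg Complex.im h0
    rw [add_im, hcim, zero_im] at h1
    have := min_le_right a ρ
    linarith
  have hcV : c ∈ {z : ℂ | -b < z.im} := by simp only [mem_ofPred_eq, hcim]; linarith
  have hHd : DifferentiableOn ℂ H {z | -b < z.im} := by
    refine (hd.mono fun z hz => ?_).sub ?_
    · exact lt_of_le_of_lt (neg_le_neg (min_le_left a ρ)) hz
    · intro z hz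
      exact (DifferentiableAt.div (differentiableAt_const _)
        (differentiableAt_id.add_const c) (hzc z hz)).differentiableWithinAt
  set q := dslope H c with hq
  have hqd : DifferentiableOn ℂ q {z | -b < z.im} :=
    (Complex.differentiableOn_dslope (hV.mem_nhds hcV)).2 hHd
  have hHc : H c = 0 := by
    have : c + c ≠ 0 := hzc c hcV
    simp only [hH, ← two_mul] at this ⊢
    rw [mul_div_assoc, div_self this, mul_one, sub_self]
  have hqe : ∀ z, z ≠ c → q z = H z / (z - c) := by
    intro z hz
    rw [hq, dslope_of_ne _ hz, slope_def_field, hHc, sub_zero]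
  set D : ℝ := C * (1 + ρ) + ‖h c * (2 * c)‖ with hD
  have hD0 : 0 ≤ D := by positivity
  have hHb : ∀ x y : ℝ, 0 ≤ y → ‖H (x + y * I)‖ ≤ D / ‖(x + y * I : ℂ) + c‖ := by
    intro x y hy
    have hne : (x + y * I : ℂ) + c ≠ 0 := hzc _ (by simp; linarith)
    have hpos : 0 < ‖(x + y * I : ℂ) + c‖ := norm_pos_iff.2 hne
    rw [hD, add_div]
    refine (norm_sub_le _ _).trans (add_le_add ?_ (norm_div _ _).le)
    refine (hb x y hy).trans ?_
    rw [le_div_iff₀ hpos]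
    have hn : ‖(x + y * I : ℂ) + c‖ ≤ (1 + x ^ 2) * (1 + y) * (1 + ρ) := by
      have : ‖(x + y * I : ℂ) + c‖ ≤ |x| + y + ρ := by
        refine (norm_add_le _ _).trans (add_le_add ((norm_add_le _ _).trans ?_) ?_)
        · simp [abs_of_nonneg hy]
        · simp [hc, abs_of_pos hρ]
      have h2 : |x| ≤ 1 + x ^ 2 := by nlinarith [sq_nonneg (|x| - 1), sq_abs x]
      have : 0 ≤ x ^ 2 * y + x ^ 2 * ρ + y * ρ + x ^ 2 * y * ρ := by positivity
      nlinarith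
    calc C * ((1 + x ^ 2)⁻¹ * (1 + y)⁻¹) * ‖(x + y * I : ℂ) + c‖
        ≤ C * ((1 + x ^ 2)⁻¹ * (1 + y)⁻¹) * ((1 + x ^ 2) * (1 + y) * (1 + ρ)) := by gcongr
      _ = C * (1 + ρ) := by
        have : 1 + y ≠ 0 := by positivity
        field_simp
  have hqb : ∀ x y : ℝ, 0 ≤ y → (x + y * I : ℂ) ≠ c →
      ‖q (x + y * I)‖ ≤ D / (‖(x + y * I : ℂ) + c‖ * ‖(x + y * I : ℂ) - c‖) := by
    intro x y hy hne
    rw [hqe _ hne, norm_div, ← div_div]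
    gcongr
    exact hHb x y hy
  have hrex : ∀ x y : ℝ, |x| ≤ ‖(x + y * I : ℂ) + c‖ ∧ |x| ≤ ‖(x + y * I : ℂ) - c‖ := by
    intro x y
    constructor
    · simpa [hc] using abs_re_le_norm ((x + y * I : ℂ) + c)
    · simpa [hc] using abs_re_le_norm ((x + y * I : ℂ) - c)
  have hside : ∀ x y : ℝ, 1 ≤ |x| → 0 ≤ y → ‖q (x + y * I)‖ ≤ D / x ^ 2 := by
    intro x y hx hy
    have hne : (x + y * I : ℂ) ≠ c := by
      intro h0
      have := congrArg Complex.re h0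
      simp [hc] at this
      rw [this] at hx
      norm_num at hx
    refine (hqb x y hy hne).trans ?_
    have hx0 : 0 < |x| := by linarith
    rw [← sq_abs x, sq]
    have := hrex x y
    gcongr
    exacts [this.1, this.2]
  have hnsq : ∀ x y : ℝ, ‖(x + y * I : ℂ) + c‖ ^ 2 = x ^ 2 + (y + ρ) ^ 2 ∧
      ‖(x + y * I : ℂ) - c‖ ^ 2 = x ^ 2 + (y - ρ) ^ 2 := by
    intro x y
    rw [← normSq_eq_norm_sq, ← normSq_eq_norm_sq, normSq_apply, normSq_apply]
    simp [hc]
    constructor <;> ring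
  have hfar : ∀ x Y : ℝ, 0 ≤ Y → Y ≠ ρ → ‖q (x + Y * I)‖ ≤ D * (x ^ 2 + (Y - ρ) ^ 2)⁻¹ := by
    intro x Y hY hYρ
    have hne : (x + Y * I : ℂ) ≠ c := by
      intro h0
      have := congrArg Complex.im h0
      simp [hc] at this
      exact hYρ this
    refine (hqb x Y hY hne).trans ?_
    obtain ⟨h1, h2⟩ := hnsq x Y
    have hp : 0 < (Y - ρ) ^ 2 := by
      have : Y - ρ ≠ 0 := sub_ne_zero.2 hYρ
      positivity
    have hpos : 0 < ‖(x + Y * I : ℂ) - c‖ := norm_pos_iff.2 (sub_ne_zero.2 hne)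
    rw [← div_eq_mul_inv, ← h2, sq]
    have hle : ‖(x + Y * I : ℂ) - c‖ ≤ ‖(x + Y * I : ℂ) + c‖ := by
      rw [← abs_of_nonneg (norm_nonneg ((x + Y * I : ℂ) - c)),
        ← abs_of_nonneg (norm_nonneg ((x + Y * I : ℂ) + c)), ← sq_le_sq, h1, h2]
      nlinarith
    gcongr
  have hcontq : ∀ y : ℝ, 0 ≤ y → Continuous fun x : ℝ => q (x + y * I) := by
    intro y hy
    refine hqd.continuousOn.comp_continuous (by fun_prop) fun x => ?_
    simp; linarith
  have h_int : ∀ y : ℝ, 0 ≤ y → y ≠ ρ → Integrable fun x : ℝ => q (x + y * I) := by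
    intro y hy hyρ
    have h1 : 0 < |y - ρ| := abs_pos.2 (sub_ne_zero.2 hyρ)
    have := ((integrable_inv_one_add_sq_scaled h1).1).const_mul D
    simp only [sq_abs] at this
    refine this.mono' (hcontq y hy).aestronglyMeasurable (ae_of_all _ fun x => hfar x y hy hyρ)
  have hq0 : (fun x : ℝ => q (x + (0 : ℝ) * I)) = fun x : ℝ => q x := by simp
  have h_int0 : Integrable fun x : ℝ => q x := by
    rw [← hq0]
    exact h_int 0 le_rfl hρ.ne
  -- The line of integration is pushed up to infinity, staying above the height of `c` because the
  -- bound `hfar` degenerates there.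
  have hzero : ∫ x : ℝ, q x = 0 := by
    have hconst : ∀ Y : ℝ, ρ + 1 ≤ Y → ∫ x : ℝ, q (x + Y * I) = ∫ x : ℝ, q x := by
      intro Y hY
      exact integral_horizontal_line_eq (C := D) (X₀ := 1) (by linarith)
        (hqd.mono fun z hz => lt_of_lt_of_le (neg_lt_zero.2 hb0) hz)
        (fun x y hx hy _ => hside x y hx hy) h_int0 (h_int Y (by linarith) (by linarith))
    have hbound : ∀ Y : ℝ, ρ + 1 ≤ Y → ‖∫ x : ℝ, q x‖ ≤ D * (Real.pi / (Y - ρ)) := by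
      intro Y hY
      have hp : 0 < Y - ρ := by linarith
      obtain ⟨i1, i2⟩ := integrable_inv_one_add_sq_scaled hp
      rw [← hconst Y hY, ← i2, ← integral_const_mul]
      exact norm_integral_le_of_norm_le (i1.const_mul D)
        (ae_of_all _ fun x => hfar x Y (by linarith) (by linarith))
    have ht : Tendsto (fun Y : ℝ => D * (Real.pi / (Y - ρ))) atTop (𝓝 (D * 0)) :=
      (Tendsto.const_div_atTop (tendsto_atTop_add_const_right _ (-ρ) tendsto_id) _).const_mul D
    rw [mul_zero] at ht
    have := ge_of_tendsto ht ((eventually_ge_atTop (ρ + 1)).mono hbound)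
    exact norm_le_zero_iff.1 this
  have hne : ∀ x : ℝ, (x : ℂ) - c ≠ 0 := by
    intro x h0
    have := congrArg Complex.im h0
    simp [hc] at this
    exact hρ.ne' this
  have hne' : ∀ x : ℝ, (x : ℂ) + c ≠ 0 := by
    intro x h0
    have := congrArg Complex.im h0
    simp [hc] at this
    exact hρ.ne' this
  obtain ⟨i1, i2⟩ := integrable_inv_one_add_sq_scaled hρ
  -- The `q` part integrates to zero; the correction term leaves an explicit arctangent integral,
  -- which carries the value `h c`.
  have e : ∀ x : ℝ, h x / (ρ + I * x) = -I * q x + 2 * ρ * h c * (((x ^ 2 + ρ ^ 2)⁻¹ : ℝ) : ℂ) := by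
    intro x
    have hx : (x : ℂ) ≠ c := sub_ne_zero.1 (hne x)
    have e1 : (ρ + I * x : ℂ) = I * (x - c) := by
      rw [hc, mul_sub, ← mul_assoc, I_mul_I]; ring
    have e2 : (((x ^ 2 + ρ ^ 2)⁻¹ : ℝ) : ℂ) = 1 / ((x + c) * (x - c)) := by
      push_cast
      rw [one_div]
      congr 1
      rw [hc]
      linear_combination ((ρ : ℂ) ^ 2) * I_sq
    rw [hqe _ hx, e1, e2, hH]
    have a1 := hne x
    have a2 := hne' x
    have hI : I ≠ 0 := I_ne_zero
    field_simp
    rw [hc]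
    ring_nf
    simp only [I_sq, I_pow_three]
    ring
  simp_rw [e]
  have i3 : Integrable fun x : ℝ => 2 * ρ * h c * (((x ^ 2 + ρ ^ 2)⁻¹ : ℝ) : ℂ) :=
    i1.ofReal.const_mul _
  rw [integral_add (h_int0.const_mul _) i3, integral_const_mul, hzero,
    integral_const_mul, integral_complex_ofReal, i2]
  have : (ρ : ℂ) ≠ 0 := by exact_mod_cast hρ.ne'
  push_cast
  field_simp
  ring

/-- Fatou's lemma for a pointwise convergent sequence with uniformly bounded integrals. -/
lemma lintegral_le_of_tendsto_of_le {α : Type*} [MeasurableSpace α] {μ : Measure α}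
    {f : ℕ → α → ENNReal} {g : α → ENNReal} {B : ENNReal} (hf : ∀ n, AEMeasurable (f n) μ)
    (hlim : ∀ᵐ x ∂μ, Tendsto (fun n => f n x) atTop (𝓝 (g x)))
    (hB : ∀ n, ∫⁻ x, f n x ∂μ ≤ B) : ∫⁻ x, g x ∂μ ≤ B := by
  have h1 : ∫⁻ x, g x ∂μ = ∫⁻ x, liminf (fun n => f n x) atTop ∂μ :=
    lintegral_congr_ae (hlim.mono fun x hx => hx.liminf_eq.symm)
  rw [h1]
  refine (lintegral_liminf_le' hf).trans ?_
  refine liminf_le_of_le (by isBoundedDefault) fun b hb => ?_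
  obtain ⟨n, hn⟩ := hb.exists
  exact hn.trans (hB n)

/-- The `L²` bound for the Fourier transform of a function in `L¹ ∩ L²`, with a Gaussian weight. -/
lemma lintegral_fourier_gaussian_le {a : ℝ → ℂ} (ha : Integrable a)
    (ha2 : Integrable fun τ => ‖a τ‖ ^ 2) {ε : ℝ} (hε : 0 < ε) :
    ∫⁻ x : ℝ, ENNReal.ofReal (‖∫ τ : ℝ, cexp (I * τ * x) * a τ‖ ^ 2 * Real.exp (-ε * x ^ 2)) ≤
      ENNReal.ofReal (2 * Real.pi * ∫ τ, ‖a τ‖ ^ 2) := by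
  set b : ℝ → ℂ := fun x => ∫ τ : ℝ, cexp (I * τ * x) * a τ with hb
  -- `G` is the Fourier transform of the Gaussian weight; its mass `2π` does not depend on `ε`.
  set G : ℝ → ℝ := fun u => √(Real.pi / ε) * Real.exp (-(1 / (4 * ε)) * u ^ 2) with hG
  have hGi : Integrable G := (integrable_exp_neg_mul_sq (by positivity)).const_mul _
  have hG0 : ∀ u, 0 ≤ G u := fun u => by positivity
  have hGI : ∫ u, G u = 2 * Real.pi := by
    rw [hG, integral_const_mul, integral_gaussian, ← Real.sqrt_mul (by positivity)]
    have : Real.pi / ε * (Real.pi / (1 / (4 * ε))) = (2 * Real.pi) ^ 2 := by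
      field_simp; norm_num
    rw [this, Real.sqrt_sq (by positivity)]
  have hexp : ∀ τ x : ℝ, ‖cexp (I * τ * x)‖ = 1 := by
    intro τ x
    rw [norm_exp]; simp
  -- The square of the transform is expanded as a double integral; the Gaussian makes the triple
  -- integral absolutely convergent, so that `x` can be integrated first.
  set Q : ℝ → ℝ × ℝ → ℂ := fun x p => cexp (I * p.1 * x) * a p.1 *
    (starRingEnd ℂ) (cexp (I * p.2 * x) * a p.2) * cexp (-ε * x ^ 2) with hQ
  have hPQ : ∀ x : ℝ, (((‖b x‖ ^ 2 * Real.exp (-ε * x ^ 2) : ℝ)) : ℂ) = ∫ p, Q x p := by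
    intro x
    rw [hQ]
    simp only
    rw [integral_mul_const]
    have := integral_prod_mul (μ := (volume : Measure ℝ)) (ν := (volume : Measure ℝ))
      (fun τ : ℝ => cexp (I * τ * x) * a τ)
      (fun σ : ℝ => (starRingEnd ℂ) (cexp (I * σ * x) * a σ))
    rw [← Measure.volume_eq_prod] at this
    rw [this, integral_conj]
    push_cast
    rw [← mul_conj']
  have hQi : Integrable (Function.uncurry Q) ((volume : Measure ℝ).prod (volume : Measure (ℝ × ℝ))) := by
    have hdom := (integrable_exp_neg_mul_sq hε).mul_prod (ha.norm.mul_prod ha.norm)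
    refine hdom.mono' ?_ (ae_of_all _ fun p => ?_)
    · have m1 : AEStronglyMeasurable (fun p : ℝ × ℝ × ℝ => a p.2.1)
          ((volume : Measure ℝ).prod ((volume : Measure ℝ).prod volume)) :=
        ha.1.comp_fst.comp_snd
      have m2 : AEStronglyMeasurable (fun p : ℝ × ℝ × ℝ => a p.2.2)
          ((volume : Measure ℝ).prod ((volume : Measure ℝ).prod volume)) :=
        ha.1.comp_snd.comp_snd
      have c1 : Continuous fun p : ℝ × ℝ × ℝ => cexp (I * p.2.1 * p.1) := by fun_prop
      have c2 : Continuous fun p : ℝ × ℝ × ℝ => cexp (I * p.2.2 * p.1) := by fun_prop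
      have c3 : Continuous fun p : ℝ × ℝ × ℝ => cexp (-ε * p.1 ^ 2) := by fun_prop
      exact ((c1.aestronglyMeasurable.mul m1).mul
        (continuous_conj.comp_aestronglyMeasurable (c2.aestronglyMeasurable.mul m2))).mul
        c3.aestronglyMeasurable
    · simp only [Function.uncurry, hQ, norm_mul, RCLike.norm_conj, hexp, one_mul]
      have : ‖cexp (-ε * p.1 ^ 2)‖ = Real.exp (-ε * p.1 ^ 2) := by
        rw [norm_exp]; norm_cast
      rw [this]
      exact le_of_eq (by ring)
  have hQx : ∀ p : ℝ × ℝ, ∫ x, Q x p = a p.1 * (starRingEnd ℂ) (a p.2) * (G (p.1 - p.2) : ℂ) := by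
    intro p
    have e : ∀ x : ℝ, Q x p = a p.1 * (starRingEnd ℂ) (a p.2) *
        (cexp (I * ((p.1 - p.2 : ℝ) : ℂ) * x) * cexp (-(ε : ℂ) * x ^ 2)) := by
      intro x
      simp only [hQ, map_mul, ← exp_conj, conj_I, conj_ofReal]
      have : cexp (I * ((p.1 - p.2 : ℝ) : ℂ) * x) = cexp (I * p.1 * x) * cexp (-I * p.2 * x) := by
        rw [← Complex.exp_add]; push_cast; ring_nf
      rw [this]
      ring
    simp_rw [e]
    rw [integral_const_mul, fourierIntegral_gaussian (by simpa using hε)]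
    congr 1
    simp only [hG]
    push_cast
    congr 1
    · rw [Real.sqrt_eq_rpow, ofReal_cpow (by positivity)]
      push_cast
      rfl
    · congr 1
      field_simp
  have hPi : Integrable fun x : ℝ => ‖b x‖ ^ 2 * Real.exp (-ε * x ^ 2) := by
    have h1 := hQi.integral_prod_left
    have h2 : Integrable fun x : ℝ => (((‖b x‖ ^ 2 * Real.exp (-ε * x ^ 2) : ℝ)) : ℂ) :=
      h1.congr (ae_of_all _ fun x => (hPQ x).symm)
    exact h2.re.congr (ae_of_all _ fun x => ofReal_re _)
  have hval : ((∫ x : ℝ, ‖b x‖ ^ 2 * Real.exp (-ε * x ^ 2) : ℝ) : ℂ) =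
      ∫ p : ℝ × ℝ, a p.1 * (starRingEnd ℂ) (a p.2) * (G (p.1 - p.2) : ℂ) := by
    rw [← integral_complex_ofReal]
    simp_rw [hPQ]
    rw [integral_integral_swap hQi]
    simp_rw [hQx]
  have hGc : Continuous G := by fun_prop
  have ham : AEMeasurable (fun τ => ENNReal.ofReal (‖a τ‖ ^ 2)) :=
    (ha.1.norm.aemeasurable.pow_const 2).ennreal_ofReal
  have hGl : ∫⁻ u, ENNReal.ofReal (G u) = ENNReal.ofReal (2 * Real.pi) := by
    rw [← ofReal_integral_eq_lintegral_ofReal hGi (ae_of_all _ hG0), hGI]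
  have hal : ∫⁻ τ, ENNReal.ofReal (‖a τ‖ ^ 2) = ENNReal.ofReal (∫ τ, ‖a τ‖ ^ 2) :=
    (ofReal_integral_eq_lintegral_ofReal ha2 (ae_of_all _ fun τ => sq_nonneg _)).symm
  have hm1 : AEMeasurable (fun p : ℝ × ℝ =>
      ENNReal.ofReal (‖a p.1‖ ^ 2) * ENNReal.ofReal (G (p.1 - p.2))) (volume.prod volume) :=
    ham.comp_fst.mul
      (by fun_prop : Measurable fun p : ℝ × ℝ => ENNReal.ofReal (G (p.1 - p.2))).aemeasurable
  have hS1 : ∫⁻ p : ℝ × ℝ, ENNReal.ofReal (‖a p.1‖ ^ 2) * ENNReal.ofReal (G (p.1 - p.2)) =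
      ENNReal.ofReal (∫ τ, ‖a τ‖ ^ 2) * ENNReal.ofReal (2 * Real.pi) := by
    rw [Measure.volume_eq_prod, lintegral_prod _ hm1]
    simp only
    rw [← hal, ← hGl, ← lintegral_mul_const'' _ ham]
    refine lintegral_congr fun τ => ?_
    rw [lintegral_const_mul _ (by fun_prop)]
    rw [lintegral_sub_left_eq_self (fun u => ENNReal.ofReal (G u)) τ]
  have hm2 : AEMeasurable (fun p : ℝ × ℝ =>
      ENNReal.ofReal (‖a p.2‖ ^ 2) * ENNReal.ofReal (G (p.1 - p.2))) (volume.prod volume) :=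
    ham.comp_snd.mul
      (by fun_prop : Measurable fun p : ℝ × ℝ => ENNReal.ofReal (G (p.1 - p.2))).aemeasurable
  have hS2 : ∫⁻ p : ℝ × ℝ, ENNReal.ofReal (‖a p.2‖ ^ 2) * ENNReal.ofReal (G (p.1 - p.2)) =
      ENNReal.ofReal (∫ τ, ‖a τ‖ ^ 2) * ENNReal.ofReal (2 * Real.pi) := by
    rw [Measure.volume_eq_prod, lintegral_prod_symm _ hm2]
    simp only
    rw [← hal, ← hGl, ← lintegral_mul_const'' _ ham]
    refine lintegral_congr fun τ => ?_
    rw [lintegral_const_mul _ (by fun_prop)]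
    rw [lintegral_sub_right_eq_self (fun u => ENNReal.ofReal (G u)) τ]
  rw [← ofReal_integral_eq_lintegral_ofReal hPi (ae_of_all _ fun x => by positivity)]
  have hP0 : 0 ≤ ∫ x : ℝ, ‖b x‖ ^ 2 * Real.exp (-ε * x ^ 2) :=
    integral_nonneg fun x => by positivity
  have hfin : ENNReal.ofReal (∫ x : ℝ, ‖b x‖ ^ 2 * Real.exp (-ε * x ^ 2)) =
      ‖∫ p : ℝ × ℝ, a p.1 * (starRingEnd ℂ) (a p.2) * (G (p.1 - p.2) : ℂ)‖ₑ := by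
    rw [← hval, ← ofReal_norm, norm_real, Real.norm_of_nonneg hP0]
  rw [hfin]
  refine (enorm_integral_le_lintegral_enorm _).trans ?_
  -- Schur's test: `|a(τ) a(σ)|` is at most half the sum of the squares, and each square is
  -- integrated against a translate of `G`.
  have hpt : ∀ p : ℝ × ℝ, ‖a p.1 * (starRingEnd ℂ) (a p.2) * (G (p.1 - p.2) : ℂ)‖ₑ ≤
      ENNReal.ofReal (1 / 2) * (ENNReal.ofReal (‖a p.1‖ ^ 2) * ENNReal.ofReal (G (p.1 - p.2)) +
        ENNReal.ofReal (‖a p.2‖ ^ 2) * ENNReal.ofReal (G (p.1 - p.2))) := by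
    intro p
    rw [← ENNReal.ofReal_mul (by positivity), ← ENNReal.ofReal_mul (by positivity),
      ← ENNReal.ofReal_add (mul_nonneg (by positivity) (hG0 _)) (mul_nonneg (by positivity) (hG0 _)),
      ← ENNReal.ofReal_mul (by positivity), ← ofReal_norm]
    refine ENNReal.ofReal_le_ofReal ?_
    rw [norm_mul, norm_mul, RCLike.norm_conj, norm_real, Real.norm_of_nonneg (hG0 _)]
    nlinarith [mul_nonneg (sq_nonneg (‖a p.1‖ - ‖a p.2‖)) (hG0 (p.1 - p.2))]
  refine (lintegral_mono hpt).trans ?_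
  rw [lintegral_const_mul' _ _ ENNReal.ofReal_ne_top, lintegral_add_left', hS1, hS2]
  · have h0 : 0 ≤ ∫ τ, ‖a τ‖ ^ 2 := integral_nonneg fun τ => sq_nonneg _
    rw [← ENNReal.ofReal_mul h0, ← ENNReal.ofReal_add (by positivity) (by positivity),
      ← ENNReal.ofReal_mul (by positivity)]
    exact ENNReal.ofReal_le_ofReal (by linarith)
  · exact hm1

/-- The `L²` bound for the Fourier transform of a function in `L¹ ∩ L²`. -/
lemma lintegral_fourier_sq_le {a : ℝ → ℂ} (ha : Integrable a)
    (ha2 : Integrable fun τ => ‖a τ‖ ^ 2) :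
    ∫⁻ x : ℝ, ENNReal.ofReal (‖∫ τ : ℝ, cexp (I * τ * x) * a τ‖ ^ 2) ≤
      ENNReal.ofReal (2 * Real.pi * ∫ τ, ‖a τ‖ ^ 2) := by
  have hbc : Continuous fun x : ℝ => ∫ τ : ℝ, cexp (I * τ * x) * a τ := by
    refine continuous_of_dominated (bound := fun τ => ‖a τ‖) (fun x => ?_) (fun x => ?_) ha.norm ?_
    · exact (by fun_prop : Continuous fun τ : ℝ =>
        cexp (I * τ * x)).aestronglyMeasurable.mul ha.1
    · refine ae_of_all _ fun τ => ?_
      rw [norm_mul, norm_exp]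
      simp
    · exact ae_of_all _ fun τ => by fun_prop
  refine lintegral_le_of_tendsto_of_le (f := fun (n : ℕ) (x : ℝ) =>
      ENNReal.ofReal (‖∫ τ : ℝ, cexp (I * τ * x) * a τ‖ ^ 2 *
        Real.exp (-(1 / ((n : ℝ) + 1)) * x ^ 2))) (fun n => ?_) (ae_of_all _ fun x => ?_)
      fun n => lintegral_fourier_gaussian_le ha ha2 (by positivity)
  · exact (ENNReal.continuous_ofReal.comp
      ((hbc.norm.pow 2).mul (by fun_prop))).aemeasurable
  · refine ENNReal.tendsto_ofReal ?_
    have h1 : Tendsto (fun n : ℕ => -(1 / ((n : ℝ) + 1)) * x ^ 2) atTop (𝓝 0) := by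
      simpa using (tendsto_one_div_add_atTop_nhds_zero_nat (𝕜 := ℝ)).neg.mul_const (x ^ 2)
    simpa using ((Real.continuous_exp.tendsto 0).comp h1).const_mul
      (‖∫ τ : ℝ, cexp (I * τ * x) * a τ‖ ^ 2)

/-- If `sₙ - uₙ ≥ 0`, `sₙ → s`, `uₙ → u` and `∫ sₙ ≤ ∫ s`, then `limsup ∫ uₙ ≤ ∫ u`. -/
lemma eventually_integral_lt_of_fatou {α : Type*} [MeasurableSpace α] {μ : Measure α}
    {s u : α → ℝ} {S V : ℕ → α → ℝ} (hS : ∀ n, Integrable (S n) μ) (hV : ∀ n, Integrable (V n) μ)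
    (hs : Integrable s μ) (hu : Integrable u μ) (hle : ∀ n x, V n x ≤ S n x)
    (hsu : ∀ x, u x ≤ s x) (hSs : ∀ n, ∫ x, S n x ∂μ ≤ ∫ x, s x ∂μ)
    (hlim : ∀ᵐ x ∂μ, Tendsto (fun n => S n x - V n x) atTop (𝓝 (s x - u x)))
    {δ : ℝ} (hδ : 0 < δ) : ∀ᶠ n in atTop, ∫ x, V n x ∂μ < (∫ x, u x ∂μ) + δ := by
  -- Otherwise `∫ V n ≥ ∫ u + δ` along a subsequence, and Fatou applied to `S - V` gives `∫ (s - u)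
  -- ≤ ∫ s - ∫ u - δ`.
  by_contra hcon
  rw [not_eventually] at hcon
  obtain ⟨φ, hφ, hφ'⟩ := extraction_of_frequently_atTop hcon
  have hB : ∫⁻ x, ENNReal.ofReal (s x - u x) ∂μ ≤
      ENNReal.ofReal ((∫ x, s x ∂μ) - ((∫ x, u x ∂μ) + δ)) := by
    refine lintegral_le_of_tendsto_of_le
      (f := fun n x => ENNReal.ofReal (S (φ n) x - V (φ n) x)) (fun n => ?_) ?_ fun n => ?_
    · exact ((hS _).sub (hV _)).1.aemeasurable.ennreal_ofReal
    · filter_upwards [hlim] with x hx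
      exact ENNReal.tendsto_ofReal (hx.comp hφ.tendsto_atTop)
    · have hi : Integrable (fun x => S (φ n) x - V (φ n) x) μ := (hS _).sub (hV _)
      rw [← ofReal_integral_eq_lintegral_ofReal hi
        (ae_of_all _ fun x => sub_nonneg.2 (hle _ x))]
      refine ENNReal.ofReal_le_ofReal ?_
      have h1 := not_lt.1 (hφ' n)
      have h2 := hSs (φ n)
      rw [integral_sub (hS _) (hV _)]
      linarith
  have hi : Integrable (fun x => s x - u x) μ := hs.sub hu
  rw [← ofReal_integral_eq_lintegral_ofReal hi
    (ae_of_all _ fun x => sub_nonneg.2 (hsu x)), integral_sub hs hu] at hB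
  have h0 : 0 ≤ (∫ x, s x ∂μ) - ∫ x, u x ∂μ := by
    rw [← integral_sub hs hu]
    exact integral_nonneg fun x => sub_nonneg.2 (hsu x)
  have h1 := not_lt.1 (hφ' 0)
  have h2 := hSs (φ 0)
  have h3 := integral_mono (hV (φ 0)) (hS (φ 0)) (hle (φ 0))
  -- Nonnegativity ensures that `ENNReal.ofReal` has not truncated the bound to `0`.
  have h4 : 0 ≤ (∫ x, s x ∂μ) - ((∫ x, u x ∂μ) + δ) := by linarith
  rw [ENNReal.ofReal_le_ofReal_iff h4] at hB
  linarith

/-- Pointwise convergence together with the bound `‖Gₙ‖₂ ≤ ‖g‖₂` implies weak convergence. -/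
lemma tendsto_integral_mul_of_norm_le {α : Type*} [MeasurableSpace α] {μ : Measure α}
    {G : ℕ → α → ℂ} {g k : α → ℂ} (hG : ∀ n, MemLp (G n) 2 μ) (hg : MemLp g 2 μ)
    (hk : MemLp k 2 μ) (hle : ∀ n, ∫ x, ‖G n x‖ ^ 2 ∂μ ≤ ∫ x, ‖g x‖ ^ 2 ∂μ)
    (hlim : ∀ᵐ x ∂μ, Tendsto (fun n => G n x) atTop (𝓝 (g x))) :
    Tendsto (fun n => ∫ x, G n x * k x ∂μ) atTop (𝓝 (∫ x, g x * k x ∂μ)) := by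
  have hgk : Integrable (fun x => g x * k x) μ := hg.integrable_mul hk
  have hGk : ∀ n, Integrable (fun x => G n x * k x) μ := fun n => (hG n).integrable_mul hk
  have hk2 := (memLp_two_iff_integrable_sq_norm hk.1).1 hk
  have hg2 := (memLp_two_iff_integrable_sq_norm hg.1).1 hg
  have hG2 := fun n => (memLp_two_iff_integrable_sq_norm (hG n).1).1 (hG n)
  have amgm : ∀ c a b : ℂ, ‖c‖ = 1 → (c * (a * b)).re ≤ ‖a‖ ^ 2 + ‖b‖ ^ 2 := by
    intro c a b hc
    refine (re_le_norm _).trans ?_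
    rw [norm_mul, norm_mul, hc]
    nlinarith [sq_nonneg (‖a‖ - ‖b‖), sq_nonneg ‖a‖, sq_nonneg ‖b‖]
  -- Fatou is applied to `‖G n‖² + ‖k‖² - Re (c G n k) ≥ 0`. The choices `c = ±1, ±I` bound the real
  -- and imaginary parts from both sides.
  have key : ∀ c : ℂ, ‖c‖ = 1 → ∀ δ : ℝ, 0 < δ → ∀ᶠ n in atTop,
      (c * ∫ x, G n x * k x ∂μ).re < (c * ∫ x, g x * k x ∂μ).re + δ := by
    intro c hc δ hδ
    have := eventually_integral_lt_of_fatou (μ := μ)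
      (S := fun n x => ‖G n x‖ ^ 2 + ‖k x‖ ^ 2) (s := fun x => ‖g x‖ ^ 2 + ‖k x‖ ^ 2)
      (V := fun n x => (c * (G n x * k x)).re) (u := fun x => (c * (g x * k x)).re)
      (fun n => (hG2 n).add hk2) (fun n => ((hGk n).const_mul c).re) (hg2.add hk2)
      (hgk.const_mul c).re (fun n x => amgm _ _ _ hc) (fun x => amgm _ _ _ hc) (fun n => ?_) ?_ hδ
    · filter_upwards [this] with n hn
      have e1 := integral_re ((hGk n).const_mul c)
      have e2 := integral_re (hgk.const_mul c)
      rw [integral_const_mul] at e1 e2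
      simp only [RCLike.re_to_complex] at e1 e2
      rwa [e1, e2] at hn
    · rw [integral_add (hG2 n) hk2, integral_add hg2 hk2]
      linarith [hle n]
    · filter_upwards [hlim] with x hx
      refine Tendsto.sub ((hx.norm.pow 2).add_const _) ?_
      exact (continuous_re.tendsto _).comp ((hx.mul_const _).const_mul _)
  rw [Metric.tendsto_atTop']
  intro ε hε
  have k1 := key 1 (by simp) (ε / 2) (by positivity)
  have k2 := key (-1) (by simp) (ε / 2) (by positivity)
  have k3 := key I (by simp) (ε / 2) (by positivity)
  have k4 := key (-I) (by simp) (ε / 2) (by positivity)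
  obtain ⟨N, hN⟩ := (k1.and (k2.and (k3.and k4))).exists_forall_of_atTop
  refine ⟨N, fun n hn => ?_⟩
  obtain ⟨a1, a2, a3, a4⟩ := hN n hn.le
  simp at a1 a2 a3 a4
  rw [dist_eq]
  refine (norm_le_abs_re_add_abs_im _).trans_lt ?_
  have b1 : |((∫ x, G n x * k x ∂μ) - ∫ x, g x * k x ∂μ).re| < ε / 2 := by
    rw [sub_re, abs_lt]; constructor <;> linarith
  have b2 : |((∫ x, G n x * k x ∂μ) - ∫ x, g x * k x ∂μ).im| < ε / 2 := by
    rw [sub_im, abs_lt]; constructor <;> linarith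
  linarith

lemma lintegral_comp_measurePreserving {α β : Type*} [MeasurableSpace α] [MeasurableSpace β]
    {μ : Measure α} {ν : Measure β} {S : α → β} (hS : MeasurePreserving S μ ν) {g : β → ENNReal}
    (hg : AEMeasurable g ν) : ∫⁻ a, g (S a) ∂μ = ∫⁻ b, g b ∂ν := by
  rw [← hS.map_eq] at hg ⊢
  exact (lintegral_map' hg hS.measurable.aemeasurable).symm

/-! ### Averaging over a family of measure-preserving rotations. -/

section Averaging

variable {X : Type*} [MeasurableSpace X] {μ : Measure X} [SFinite μ] {T : ℝ → X → X}
  {f f₀ : X → ℂ}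

/-- Allows the average over `θ` to be exchanged with the integral over `X` by Fubini on the product.
-/
lemma measurePreserving_skew (hT : Measurable (Function.uncurry T))
    (hμ : ∀ θ, MeasurePreserving (T θ) μ μ) :
    MeasurePreserving (fun p : ℝ × X => (p.1, T p.1 p.2))
      ((volume.restrict (Ioc 0 (2 * Real.pi))).prod μ)
      ((volume.restrict (Ioc 0 (2 * Real.pi))).prod μ) :=
  (MeasurePreserving.id _).skew_product hT (ae_of_all _ fun θ => (hμ θ).map_eq)

/-- If `f₀(x)` is the value at the centre of a holomorphic function on the disc whose boundary
values are those of `f` along the orbit of `x`, then `‖f₀‖₂ ≤ ‖f‖₂`. -/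
lemma lintegral_center_sq_le (hT : Measurable (Function.uncurry T))
    (hμ : ∀ θ, MeasurePreserving (T θ) μ μ) (hf : AEStronglyMeasurable f μ)
    (hd : ∀ᵐ x ∂μ, ∃ h : ℂ → ℂ, DiffContOnCl ℂ h (Metric.ball 0 1) ∧ h 0 = f₀ x ∧
      ∀ θ, h (circleMap 0 1 θ) = f (T θ x)) :
    ∫⁻ x, ‖f₀ x‖ₑ ^ 2 ∂μ ≤ ∫⁻ x, ‖f x‖ₑ ^ 2 ∂μ := by
  have hpi : (0 : ℝ) ≤ 2 * Real.pi := by positivity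
  have hc0 : ENNReal.ofReal (2 * Real.pi) ≠ 0 := by simp [Real.pi_pos]
  have hS := measurePreserving_skew hT hμ
  have hm0 : AEMeasurable (fun x => ‖f x‖ₑ ^ 2) μ := hf.enorm.pow_const 2
  have hm : AEMeasurable (fun p : ℝ × X => ‖f p.2‖ₑ ^ 2)
      ((volume.restrict (Ioc 0 (2 * Real.pi))).prod μ) := hm0.comp_snd
  have e1 : ∫⁻ p : ℝ × X, ‖f (T p.1 p.2)‖ₑ ^ 2 ∂((volume.restrict (Ioc 0 (2 * Real.pi))).prod μ) =
      ENNReal.ofReal (2 * Real.pi) * ∫⁻ x, ‖f x‖ₑ ^ 2 ∂μ := by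
    have this : ∫⁻ q : ℝ × X, ‖f q.2‖ₑ ^ 2 ∂((volume.restrict (Ioc 0 (2 * Real.pi))).prod μ) =
        ∫⁻ p : ℝ × X, ‖f (T p.1 p.2)‖ₑ ^ 2 ∂((volume.restrict (Ioc 0 (2 * Real.pi))).prod μ) :=
      (lintegral_comp_measurePreserving hS hm).symm
    rw [← this, lintegral_prod _ hm]
    simp only [lintegral_const, Measure.restrict_apply_univ, Real.volume_Ioc, sub_zero]
    rw [mul_comm]
  have hm' : AEMeasurable (fun p : ℝ × X => ‖f (T p.1 p.2)‖ₑ ^ 2)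
      ((volume.restrict (Ioc 0 (2 * Real.pi))).prod μ) := by
    have h := hm.comp_quasiMeasurePreserving hS.quasiMeasurePreserving
    exact h
  rw [lintegral_prod_symm _ hm'] at e1
  rw [← ENNReal.mul_le_mul_iff_right hc0 ENNReal.ofReal_ne_top, ← e1,
    ← lintegral_const_mul' _ _ ENNReal.ofReal_ne_top]
  refine lintegral_mono_ae ?_
  filter_upwards [hd] with x ⟨h, hh, hh0, hhT⟩
  -- The mean value property of `h²`, instead of `h`, bounds `|h 0|²` by the mean of `|h|²` without
  -- Cauchy–Schwarz.
  have hmean : Real.circleAverage (fun z => h z ^ 2) 0 1 = h 0 ^ 2 := by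
    refine DiffContOnCl.circleAverage ?_
    rw [abs_one]
    exact ⟨hh.1.pow 2, hh.2.pow 2⟩
  rw [Real.circleAverage_def, inv_smul_eq_iff₀ (by positivity),
    intervalIntegral.integral_of_le hpi] at hmean
  have h2 : ENNReal.ofReal (2 * Real.pi) * ‖f₀ x‖ₑ ^ 2 = ‖(2 * Real.pi) • h 0 ^ 2‖ₑ := by
    rw [enorm_smul, enorm_pow, hh0, Real.enorm_of_nonneg hpi]
  rw [h2, ← hmean]
  refine (enorm_integral_le_lintegral_enorm _).trans (le_of_eq ?_)
  refine lintegral_congr fun θ => ?_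
  rw [enorm_pow, hhT]

/-- With `f₀` as in `lintegral_center_sq_le`, the functions `f` and `f₀` have the same integral
against every function that is constant on orbits. -/
lemma integral_center_mul_eq {κ : X → ℂ} (hT : Measurable (Function.uncurry T))
    (hμ : ∀ θ, MeasurePreserving (T θ) μ μ) (hfκ : Integrable (fun x => f x * κ x) μ)
    (hκ : ∀ θ x, κ (T θ x) = κ x)
    (hd : ∀ᵐ x ∂μ, ∃ h : ℂ → ℂ, DiffContOnCl ℂ h (Metric.ball 0 1) ∧ h 0 = f₀ x ∧
      ∀ θ, h (circleMap 0 1 θ) = f (T θ x)) :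
    ∫ x, f₀ x * κ x ∂μ = ∫ x, f x * κ x ∂μ := by
  have hpi : (0 : ℝ) ≤ 2 * Real.pi := by positivity
  have hS := measurePreserving_skew hT hμ
  have hm : Integrable (fun p : ℝ × X => f p.2 * κ p.2)
      ((volume.restrict (Ioc 0 (2 * Real.pi))).prod μ) := hfκ.comp_snd _
  have hm' : Integrable (fun p : ℝ × X => f (T p.1 p.2) * κ p.2)
      ((volume.restrict (Ioc 0 (2 * Real.pi))).prod μ) := by
    have := hS.integrable_comp_of_integrable hm
    simpa [Function.comp_def, hκ] using this
  have e1 : ∫ p : ℝ × X, f (T p.1 p.2) * κ p.2 ∂((volume.restrict (Ioc 0 (2 * Real.pi))).prod μ) =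
      (2 * Real.pi) • ∫ x, f x * κ x ∂μ := by
    have := integral_map (hS.measurable.aemeasurable) (f := fun p : ℝ × X => f p.2 * κ p.2)
      (by rw [hS.map_eq]; exact hm.1)
    rw [hS.map_eq] at this
    simp only [hκ] at this
    rw [← this, integral_prod _ hm]
    simp [Real.pi_pos.le]
  rw [integral_prod_symm _ hm'] at e1
  have e2 : ∫ x, (∫ θ in Ioc 0 (2 * Real.pi), f (T θ x) * κ x) ∂μ =
      ∫ x, (2 * Real.pi) • (f₀ x * κ x) ∂μ := by
    refine integral_congr_ae ?_
    filter_upwards [hd] with x ⟨h, hh, hh0, hhT⟩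
    have hmean : Real.circleAverage h 0 1 = h 0 := by
      refine DiffContOnCl.circleAverage ?_
      rwa [abs_one]
    rw [Real.circleAverage_def, inv_smul_eq_iff₀ (by positivity),
      intervalIntegral.integral_of_le hpi] at hmean
    simp only [hhT, hh0] at hmean
    rw [integral_mul_const, hmean, smul_mul_assoc]
  rw [e2, integral_smul] at e1
  exact smul_right_injective ℂ (r := 2 * Real.pi) (by positivity) e1

end Averaging

/-! ### Laplace transforms of densities on the half line -/

section Laplace

variable {w : ℝ → ℝ} {δ : ℝ}

/-- The measure with density `w` on the half line. -/
def densityMeasure (w : ℝ → ℝ) : Measure ℝ :=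
  (volume.restrict (Ioi 0)).withDensity fun τ => ENNReal.ofReal (w τ)

lemma integral_densityMeasure {E : Type*} [NormedAddCommGroup E] [NormedSpace ℝ E]
    (hw : Measurable w) (h0 : ∀ τ, 0 < τ → 0 ≤ w τ) (f : ℝ → E) :
    ∫ τ, f τ ∂(densityMeasure w) = ∫ τ in Ioi 0, w τ • f τ := by
  rw [densityMeasure, integral_withDensity_eq_integral_toReal_smul (by fun_prop)
    (ae_of_all _ fun τ => ENNReal.ofReal_lt_top)]
  refine setIntegral_congr_fun measurableSet_Ioi fun τ hτ => ?_
  simp only [ENNReal.toReal_ofReal (h0 τ hτ)]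

/-- The Laplace transform of `w` is the moment generating function of `-τ` under `densityMeasure w`,
which is analytic on the interior of its set of convergence. -/
lemma Ioi_subset_interior_integrableExpSet (hw : Measurable w) (h0 : ∀ τ, 0 < τ → 0 ≤ w τ)
    (h_int : ∀ t, δ < t → IntegrableOn (fun τ => Real.exp (-t * τ) * w τ) (Ioi 0)) :
    Ioi δ ⊆ interior (ProbabilityTheory.integrableExpSet (fun τ : ℝ => -τ) (densityMeasure w)) := by
  refine interior_maximal (fun t ht => ?_) isOpen_Ioi
  rw [ProbabilityTheory.integrableExpSet, mem_ofPred_eq, densityMeasure,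
    integrable_withDensity_iff_integrable_smul₀' (by fun_prop)
      (ae_of_all _ fun τ => ENNReal.ofReal_lt_top)]
  refine (h_int t ht).congr_fun (fun τ hτ => ?_) measurableSet_Ioi
  simp only [ENNReal.toReal_ofReal (h0 τ hτ), smul_eq_mul]
  rw [mul_comm]
  congr 2
  ring

lemma analyticOnNhd_laplace (hw : Measurable w) (h0 : ∀ τ, 0 < τ → 0 ≤ w τ)
    (h_int : ∀ t, δ < t → IntegrableOn (fun τ => Real.exp (-t * τ) * w τ) (Ioi 0)) :
    AnalyticOnNhd ℝ (fun t => ∫ τ in Ioi 0, Real.exp (-t * τ) * w τ) (Ioi δ) := by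
  have h := (ProbabilityTheory.analyticOnNhd_mgf (X := fun τ : ℝ => -τ)
    (μ := densityMeasure w)).mono (Ioi_subset_interior_integrableExpSet hw h0 h_int)
  have e : (fun t => ∫ τ in Ioi 0, Real.exp (-t * τ) * w τ) =
      ProbabilityTheory.mgf (fun τ : ℝ => -τ) (densityMeasure w) := by
    ext t
    rw [ProbabilityTheory.mgf, integral_densityMeasure hw h0]
    simp [mul_comm]
  rwa [e]

lemma differentiableOn_laplace (hw : Measurable w) (h0 : ∀ τ, 0 < τ → 0 ≤ w τ)
    (h_int : ∀ t, δ < t → IntegrableOn (fun τ => Real.exp (-t * τ) * w τ) (Ioi 0)) :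
    DifferentiableOn ℂ (fun s : ℂ => ∫ τ in Ioi (0 : ℝ), cexp (-s * τ) * w τ) {s | δ < s.re} := by
  have h := (ProbabilityTheory.differentiableOn_complexMGF (X := fun τ : ℝ => -τ)
    (μ := densityMeasure w)).mono (s := {s : ℂ | δ < s.re})
      fun s hs => Ioi_subset_interior_integrableExpSet hw h0 h_int hs
  have e : (fun s : ℂ => ∫ τ in Ioi (0 : ℝ), cexp (-s * τ) * w τ) =
      ProbabilityTheory.complexMGF (fun τ : ℝ => -τ) (densityMeasure w) := by
    ext t
    rw [ProbabilityTheory.complexMGF, integral_densityMeasure hw h0]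
    simp [mul_comm]
  rwa [e]

end Laplace

/-! ### Weighted Bergman spaces of the upper half plane -/

/-- The conditions on a measure `Λ` on the line under which the Bergman space of the upper half
plane with the weight `dx ⊗ Λ` is treated here. -/
structure IsHalfPlaneWeight (Λ : Measure ℝ) : Prop where
  -- `decay` makes the Laplace transform finite. `shift` makes upward translation a contraction of
  -- the weighted space. `lower` keeps the reciprocal of the transform subexponential and compares
  -- `Λ` with Lebesgue measure away from the boundary.
  null : Λ (Iic 0) = 0
  decay : ∃ m : ℕ, Integrable (fun y : ℝ => ((1 + y) ^ m)⁻¹) Λ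
  shift : ∀ ε : ℝ, 0 < ε → Λ.map (· + ε) ≤ Λ
  lower : ∀ a : ℝ, 0 < a → ∃ c : ENNReal, c ≠ 0 ∧ c ≠ ⊤ ∧ c • volume.restrict (Ioi a) ≤ Λ

/-- `∫ e^{-2τy} dΛ(y)`. -/
def weightLaplace (Λ : Measure ℝ) (τ : ℝ) : ℝ := ∫ y, Real.exp (-2 * τ * y) ∂Λ

/-- The function `K` such that `K(z - w̄)` is the reproducing kernel of the half plane with the
weight `dx ⊗ Λ`. -/
def halfPlaneKernel (Λ : Measure ℝ) (s : ℂ) : ℂ :=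
  1 / (2 * Real.pi) * ∫ τ in Ioi (0 : ℝ), cexp (I * s * τ) * ((weightLaplace Λ τ)⁻¹ : ℝ)

section Weight

variable {Λ : Measure ℝ}

lemma IsHalfPlaneWeight.ae_pos (hΛ : IsHalfPlaneWeight Λ) : ∀ᵐ y ∂Λ, 0 < y := by
  rw [ae_iff]
  have : {a : ℝ | ¬0 < a} = Iic 0 := by ext; simp
  rw [this, hΛ.null]

lemma IsHalfPlaneWeight.integrable_exp (hΛ : IsHalfPlaneWeight Λ) {τ : ℝ} (hτ : 0 < τ) :
    Integrable (fun y => Real.exp (-2 * τ * y)) Λ := by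
  obtain ⟨m, hm⟩ := hΛ.decay
  refine (hm.const_mul (m.factorial / (2 * τ) ^ m * Real.exp (2 * τ))).mono'
    (by fun_prop) (hΛ.ae_pos.mono fun y hy => ?_)
  rw [Real.norm_of_nonneg (Real.exp_nonneg _)]
  -- The exponential beats the power `(1 + y) ^ m`; the shift from `y` to `1 + y` costs the factor
  -- `e^{2τ}`.
  have h1 := Real.pow_div_factorial_le_exp (2 * τ * (1 + y)) (by positivity) m
  have h2 : Real.exp (-2 * τ * y) = Real.exp (2 * τ) / Real.exp (2 * τ * (1 + y)) := by
    rw [← Real.exp_sub]; congr 1; ring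
  rw [h2, div_le_iff₀ (Real.exp_pos _)]
  have h3 : 0 < (1 + y) ^ m := by positivity
  calc Real.exp (2 * τ) = m.factorial / (2 * τ) ^ m * Real.exp (2 * τ) * ((1 + y) ^ m)⁻¹ *
        ((2 * τ * (1 + y)) ^ m / m.factorial) := by
        rw [mul_pow (2 * τ) (1 + y)]
        field_simp
    _ ≤ _ := by gcongr

/-- On `(η/4, η/2]` the weight dominates a multiple of Lebesgue measure and `e^{-2τy} ≥ e^{-ητ}`.
The reciprocal thus grows more slowly than any exponential, which makes the integrals over `τ` below
converge at every positive exponent. -/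
lemma IsHalfPlaneWeight.exists_inv_weightLaplace_le (hΛ : IsHalfPlaneWeight Λ) {η : ℝ}
    (hη : 0 < η) :
    ∃ C : ℝ, 0 < C ∧ ∀ τ, 0 < τ →
      0 < weightLaplace Λ τ ∧ (weightLaplace Λ τ)⁻¹ ≤ C * Real.exp (η * τ) := by
  obtain ⟨c, hc0, hct, hc⟩ := hΛ.lower (η / 4) (by positivity)
  have hcp : 0 < c.toReal := ENNReal.toReal_pos hc0 hct
  have key : ∀ τ, 0 < τ → c.toReal * (η / 4) * Real.exp (-η * τ) ≤ weightLaplace Λ τ := by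
    intro τ hτ
    have hi := hΛ.integrable_exp hτ
    have hi1 := hi.mono_measure hc
    have h1 : ∫ y, Real.exp (-2 * τ * y) ∂(c • volume.restrict (Ioi (η / 4))) ≤
        weightLaplace Λ τ :=
      integral_mono_measure hc (ae_of_all _ fun y => (Real.exp_pos _).le) hi
    refine le_trans ?_ h1
    rw [integral_smul_measure, smul_eq_mul, mul_assoc]
    gcongr
    have hi2 : IntegrableOn (fun y => Real.exp (-2 * τ * y)) (Ioi (η / 4)) :=
      (integrable_smul_measure hc0 hct).1 hi1
    have h3 : ∫ y in Ioc (η / 4) (η / 2), Real.exp (-η * τ) = η / 4 * Real.exp (-η * τ) := by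
      rw [setIntegral_const]
      simp only [measureReal_def, Real.volume_Ioc, smul_eq_mul]
      rw [ENNReal.toReal_ofReal (by linarith)]
      ring
    rw [← h3]
    refine le_trans (setIntegral_mono_on (integrableOn_const (by simp))
      (hi2.mono_set Ioc_subset_Ioi_self) measurableSet_Ioc fun y hy => ?_)
      (setIntegral_mono_set hi2 (ae_of_all _ fun y => (Real.exp_pos _).le)
        (Ioc_subset_Ioi_self.eventuallyLE))
    refine Real.exp_le_exp.2 ?_
    have := hy.2
    nlinarith
  refine ⟨(c.toReal * (η / 4))⁻¹, by positivity, fun τ hτ => ?_⟩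
  have hpos : 0 < c.toReal * (η / 4) * Real.exp (-η * τ) := by positivity
  refine ⟨hpos.trans_le (key τ hτ), ?_⟩
  refine (inv_anti₀ hpos (key τ hτ)).trans (le_of_eq ?_)
  rw [mul_inv, ← Real.exp_neg]
  congr 2
  ring

lemma IsHalfPlaneWeight.weightLaplace_pos (hΛ : IsHalfPlaneWeight Λ) {τ : ℝ} (hτ : 0 < τ) :
    0 < weightLaplace Λ τ := by
  obtain ⟨C, -, hC⟩ := hΛ.exists_inv_weightLaplace_le one_pos
  exact (hC τ hτ).1

lemma measurable_weightLaplace [SFinite Λ] : Measurable (weightLaplace Λ) := by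
  have : Measurable (Function.uncurry fun τ y : ℝ => Real.exp (-2 * τ * y)) := by
    unfold Function.uncurry; fun_prop
  exact (this.stronglyMeasurable.integral_prod_right).measurable

lemma IsHalfPlaneWeight.integrableOn_exp_mul_inv_pow (hΛ : IsHalfPlaneWeight Λ) [SFinite Λ]
    {t : ℝ} (ht : 0 < t) (j : ℕ) :
    IntegrableOn (fun τ => Real.exp (-t * τ) * ((weightLaplace Λ τ)⁻¹) ^ j) (Ioi 0) := by
  -- The `j` factors together cost at most `e^{tτ/2}`, half of the available decay; `j + 1` keeps
  -- the denominator nonzero for `j = 0`.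
  obtain ⟨C, hC0, hC⟩ := hΛ.exists_inv_weightLaplace_le (η := t / (2 * (j + 1))) (by positivity)
  have hd : IntegrableOn (fun τ => C ^ j * Real.exp (-(t / 2) * τ)) (Ioi 0) :=
    (integrableOn_exp_mul_Ioi (by linarith) 0).const_mul _
  refine Integrable.mono' hd ?_ ?_
  · exact ((by fun_prop : Measurable fun τ : ℝ => Real.exp (-t * τ)).mul
      (measurable_weightLaplace.inv.pow_const j)).aestronglyMeasurable
  · refine (ae_restrict_iff' measurableSet_Ioi).2 (ae_of_all _ fun τ hτ => ?_)
    have hτ0 : (0 : ℝ) < τ := hτ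
    obtain ⟨h1, h2⟩ := hC τ hτ
    rw [Real.norm_of_nonneg (by positivity)]
    calc Real.exp (-t * τ) * (weightLaplace Λ τ)⁻¹ ^ j
        ≤ Real.exp (-t * τ) * (C * Real.exp (t / (2 * (j + 1)) * τ)) ^ j := by gcongr
      _ = C ^ j * Real.exp (-t * τ + j * (t / (2 * (j + 1)) * τ)) := by
        rw [Real.exp_add, mul_pow, ← Real.exp_nat_mul]; ring
      _ ≤ C ^ j * Real.exp (-(t / 2) * τ) := by
        gcongr
        have : (j : ℝ) * (t / (2 * (j + 1)) * τ) ≤ t / 2 * τ := by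
          have e : (j : ℝ) * (t / (2 * (j + 1)) * τ) = t / 2 * τ * (j / (j + 1)) := by
            field_simp
          rw [e]
          refine mul_le_of_le_one_right (by positivity) ?_
          rw [div_le_one (by positivity)]
          linarith
        linarith

lemma IsHalfPlaneWeight.integrableOn_exp_mul_inv (hΛ : IsHalfPlaneWeight Λ) [SFinite Λ]
    {t : ℝ} (ht : 0 < t) :
    IntegrableOn (fun τ => Real.exp (-t * τ) * (weightLaplace Λ τ)⁻¹) (Ioi 0) := by
  simpa using hΛ.integrableOn_exp_mul_inv_pow ht 1

lemma IsHalfPlaneWeight.differentiableOn_halfPlaneKernel (hΛ : IsHalfPlaneWeight Λ) [SFinite Λ] :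
    DifferentiableOn ℂ (halfPlaneKernel Λ) {s | 0 < s.im} := by
  have h := differentiableOn_laplace (w := fun τ => (weightLaplace Λ τ)⁻¹) (δ := 0)
    measurable_weightLaplace.inv (fun τ hτ => (inv_pos.2 (hΛ.weightLaplace_pos hτ)).le)
    fun t ht => hΛ.integrableOn_exp_mul_inv ht
  have h2 : DifferentiableOn ℂ (fun s : ℂ => ∫ τ in Ioi (0 : ℝ),
      cexp (-(-(I * s)) * τ) * ((weightLaplace Λ τ)⁻¹ : ℝ)) {s | 0 < s.im} :=
    h.comp (t := {s : ℂ | (0 : ℝ) < s.re}) (f := fun s : ℂ => -(I * s)) (by fun_prop)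
      fun s hs => by simpa using hs
  simp only [neg_neg] at h2
  exact h2.const_mul _

/-- On each horizontal line the kernel is a Fourier transform, so its square integral is controlled
by that of `e^{-(y+ρ)τ} A(τ)⁻¹`, where `A = weightLaplace Λ`. Integration in `y` turns `e^{-2τy}`
into `A(τ)`, which cancels one of the two factors `A(τ)⁻¹`. -/
lemma IsHalfPlaneWeight.memLp_halfPlaneKernel (hΛ : IsHalfPlaneWeight Λ) [SFinite Λ]
    {ρ : ℝ} (hρ : 0 < ρ) :
    MemLp (fun p : ℝ × ℝ => halfPlaneKernel Λ (p.1 + p.2 * I + ρ * I)) 2 (volume.prod Λ) := by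
  have hpos : ∀ᵐ p : ℝ × ℝ ∂(volume.prod Λ), 0 < p.2 := by
    have := (Measure.quasiMeasurePreserving_snd (μ := (volume : Measure ℝ)) (ν := Λ)).ae hΛ.ae_pos
    exact this
  have hopen : IsOpen {p : ℝ × ℝ | 0 < p.2} := isOpen_lt continuous_const continuous_snd
  have hcont : ContinuousOn (fun p : ℝ × ℝ => halfPlaneKernel Λ (p.1 + p.2 * I + ρ * I))
      {p | 0 < p.2} := by
    refine hΛ.differentiableOn_halfPlaneKernel.continuousOn.comp (by fun_prop) fun p hp => ?_
    have : 0 < p.2 := hp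
    simp
    linarith
  have hres : (volume.prod Λ).restrict {p : ℝ × ℝ | 0 < p.2} = volume.prod Λ :=
    Measure.restrict_eq_self_of_ae_mem hpos
  have hmeas : AEStronglyMeasurable
      (fun p : ℝ × ℝ => halfPlaneKernel Λ (p.1 + p.2 * I + ρ * I)) (volume.prod Λ) := by
    rw [← hres]
    exact hcont.aestronglyMeasurable hopen.measurableSet
  rw [memLp_two_iff_integrable_sq_norm hmeas]
  refine ⟨hmeas.norm.pow 2, ?_⟩
  have hA := measurable_weightLaplace (Λ := Λ)
  have hslice : ∀ y : ℝ, 0 < y →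
      ∫⁻ x : ℝ, ENNReal.ofReal (‖halfPlaneKernel Λ (x + y * I + ρ * I)‖ ^ 2) ≤
        ∫⁻ τ in Ioi 0, ENNReal.ofReal (1 / (2 * Real.pi) * (Real.exp (-2 * τ * y) *
          (Real.exp (-(2 * ρ) * τ) * (weightLaplace Λ τ)⁻¹ ^ 2))) := by
    intro y hy
    set a : ℝ → ℂ := (Ioi (0 : ℝ)).indicator fun τ =>
      ((1 / (2 * Real.pi) * (Real.exp (-(y + ρ) * τ) * (weightLaplace Λ τ)⁻¹) : ℝ) : ℂ) with ha
    have hai : Integrable a := by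
      rw [ha, integrable_indicator_iff measurableSet_Ioi]
      exact ((hΛ.integrableOn_exp_mul_inv (by linarith : 0 < y + ρ)).const_mul _).ofReal
    have ha2 : (fun τ => ‖a τ‖ ^ 2) = (Ioi (0 : ℝ)).indicator fun τ =>
        (1 / (2 * Real.pi)) ^ 2 * (Real.exp (-(2 * (y + ρ)) * τ) * (weightLaplace Λ τ)⁻¹ ^ 2) := by
      ext τ
      by_cases hτ : τ ∈ Ioi (0 : ℝ)
      · rw [ha, indicator_of_mem hτ, indicator_of_mem hτ, norm_real, Real.norm_eq_abs, sq_abs,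
          mul_pow, mul_pow, ← Real.exp_nat_mul]
        congr 3
        push_cast
        ring
      · rw [ha, indicator_of_notMem hτ, indicator_of_notMem hτ]
        simp
    have hi2 : IntegrableOn (fun τ => (1 / (2 * Real.pi)) ^ 2 *
        (Real.exp (-(2 * (y + ρ)) * τ) * (weightLaplace Λ τ)⁻¹ ^ 2)) (Ioi 0) :=
      (hΛ.integrableOn_exp_mul_inv_pow (by linarith : 0 < 2 * (y + ρ)) 2).const_mul _
    have hai2 : Integrable fun τ => ‖a τ‖ ^ 2 := by
      rw [ha2, integrable_indicator_iff measurableSet_Ioi]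
      exact hi2
    have hK : ∀ x : ℝ, halfPlaneKernel Λ (x + y * I + ρ * I) = ∫ τ : ℝ, cexp (I * τ * x) * a τ := by
      intro x
      rw [halfPlaneKernel, ← integral_const_mul, ← integral_indicator measurableSet_Ioi]
      refine integral_congr_ae (ae_of_all _ fun τ => ?_)
      by_cases hτ : τ ∈ Ioi (0 : ℝ)
      · simp only [ha, indicator_of_mem hτ]
        push_cast
        have : cexp (I * (x + y * I + ρ * I) * τ) = cexp (I * τ * x) * cexp (-(y + ρ) * τ) := by
          rw [← Complex.exp_add]
          congr 1
          linear_combination ((y : ℂ) * τ + ρ * τ) * I_sq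
        rw [this]
        ring
      · simp only [ha, indicator_of_notMem hτ, mul_zero]
    simp_rw [hK]
    refine (lintegral_fourier_sq_le hai hai2).trans (le_of_eq ?_)
    rw [ha2, integral_indicator measurableSet_Ioi, ← integral_const_mul,
      ofReal_integral_eq_lintegral_ofReal (hi2.const_mul _)]
    · refine setLIntegral_congr_fun measurableSet_Ioi fun τ hτ => ?_
      congr 1
      have : Real.exp (-(2 * (y + ρ)) * τ) = Real.exp (-2 * τ * y) * Real.exp (-(2 * ρ) * τ) := by
        rw [← Real.exp_add]; congr 1; ring
      rw [this]
      have := Real.pi_pos.ne'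
      field_simp
    · exact ae_of_all _ fun τ => by positivity
  have hpt : ∀ p : ℝ × ℝ, ‖‖halfPlaneKernel Λ (p.1 + p.2 * I + ρ * I)‖ ^ 2‖ₑ =
      ENNReal.ofReal (‖halfPlaneKernel Λ (p.1 + p.2 * I + ρ * I)‖ ^ 2) := by
    intro p
    exact Real.enorm_of_nonneg (sq_nonneg _)
  rw [hasFiniteIntegral_iff_enorm]
  simp_rw [hpt]
  have hmeas2 : AEMeasurable (fun p : ℝ × ℝ =>
      ENNReal.ofReal (‖halfPlaneKernel Λ (p.1 + p.2 * I + ρ * I)‖ ^ 2)) (volume.prod Λ) :=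
    (hmeas.norm.aemeasurable.pow_const 2).ennreal_ofReal
  rw [lintegral_prod_symm _ hmeas2]
  refine lt_of_le_of_lt (lintegral_mono_ae (hΛ.ae_pos.mono fun y hy => hslice y hy)) ?_
  rw [lintegral_lintegral_swap]
  · have hτ : ∀ τ ∈ Ioi (0 : ℝ), ∫⁻ y, ENNReal.ofReal (1 / (2 * Real.pi) * (Real.exp (-2 * τ * y) *
        (Real.exp (-(2 * ρ) * τ) * (weightLaplace Λ τ)⁻¹ ^ 2))) ∂Λ =
        ENNReal.ofReal (1 / (2 * Real.pi) * (Real.exp (-(2 * ρ) * τ) * (weightLaplace Λ τ)⁻¹)) := by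
      intro τ hτ
      rw [← ofReal_integral_eq_lintegral_ofReal
        (((hΛ.integrable_exp hτ).mul_const _).const_mul _) (ae_of_all _ fun y => by positivity),
        integral_const_mul, integral_mul_const]
      have h1 := (hΛ.weightLaplace_pos hτ).ne'
      change ENNReal.ofReal (1 / (2 * Real.pi) * (weightLaplace Λ τ * _)) = _
      congr 1
      field_simp
    rw [setLIntegral_congr_fun measurableSet_Ioi hτ]
    exact ((hΛ.integrableOn_exp_mul_inv (by linarith : 0 < 2 * ρ)).const_mul _).lintegral_lt_top
  · have : Measurable (Function.uncurry fun y τ : ℝ => ENNReal.ofReal (1 / (2 * Real.pi) *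
        (Real.exp (-2 * τ * y) * (Real.exp (-(2 * ρ) * τ) * (weightLaplace Λ τ)⁻¹ ^ 2)))) := by
      unfold Function.uncurry
      have h1 : Measurable fun p : ℝ × ℝ => weightLaplace Λ p.2 := hA.comp measurable_snd
      fun_prop
    exact this.aemeasurable

end Weight

/-- The reproducing property for functions that are holomorphic across the boundary of the half
plane and decay at infinity. -/
lemma IsHalfPlaneWeight.integral_mul_conj_kernel_of_decay {Λ : Measure ℝ} [SFinite Λ]
    (hΛ : IsHalfPlaneWeight Λ) {h : ℂ → ℂ} {a C ρ : ℝ} {m : ℕ} (ha : 0 < a) (hρ : 0 < ρ)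
    (hm : 1 ≤ m) (hΛm : Integrable (fun y : ℝ => ((1 + y) ^ m)⁻¹) Λ)
    (hd : DifferentiableOn ℂ h {z | -a < z.im})
    (hb : ∀ x y : ℝ, 0 ≤ y → ‖h (x + y * I)‖ ≤ C * ((1 + x ^ 2)⁻¹ * ((1 + y) ^ m)⁻¹)) :
    ∫ p : ℝ × ℝ, h (p.1 + p.2 * I) *
      (starRingEnd ℂ) (halfPlaneKernel Λ (p.1 + p.2 * I + ρ * I)) ∂(volume.prod Λ) =
      h (I * ρ) := by
  have hC : 0 ≤ C := by
    have := (norm_nonneg _).trans (hb 0 0 le_rfl)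
    simpa using this
  set A := weightLaplace Λ with hA
  have hAm : Measurable A := measurable_weightLaplace
  have hpos : ∀ᵐ p : ℝ × ℝ ∂(volume.prod Λ), 0 < p.2 := by
    have := (Measure.quasiMeasurePreserving_snd (μ := (volume : Measure ℝ)) (ν := Λ)).ae hΛ.ae_pos
    exact this
  have hopen : IsOpen {p : ℝ × ℝ | 0 < p.2} := isOpen_lt continuous_const continuous_snd
  have hhc : ContinuousOn (fun p : ℝ × ℝ => h (p.1 + p.2 * I)) {p | 0 < p.2} := by
    refine hd.continuousOn.comp (by fun_prop) fun p hp => ?_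
    have : 0 < p.2 := hp
    simp
    linarith
  have hhm : AEStronglyMeasurable (fun p : ℝ × ℝ => h (p.1 + p.2 * I)) (volume.prod Λ) := by
    rw [← Measure.restrict_eq_self_of_ae_mem hpos]
    exact hhc.aestronglyMeasurable hopen.measurableSet
  have hhx : ∀ y : ℝ, 0 ≤ y → Continuous fun x : ℝ => h (x + y * I) := by
    intro y hy
    refine hd.continuousOn.comp_continuous (by fun_prop) fun x => ?_
    simp; linarith
  -- The conjugated exponential is split as `e^{-iτz̄} = e^{-iτz} e^{-2τy}`: a factor holomorphic in
  -- `z`, whose line integrals can be shifted, and a factor depending on `y` alone.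
  set J : ℝ × ℝ → ℝ → ℂ := fun p τ => h (p.1 + p.2 * I) * cexp (-I * τ * (p.1 + p.2 * I)) *
    (Real.exp (-2 * τ * p.2) : ℝ) * ((1 / (2 * Real.pi) * (Real.exp (-ρ * τ) * (A τ)⁻¹) : ℝ) : ℂ)
    with hJ
  have hJnorm : ∀ (p : ℝ × ℝ) (τ : ℝ), 0 < p.2 → 0 < τ → ‖J p τ‖ ≤
      C * ((1 + p.1 ^ 2)⁻¹ * ((1 + p.2) ^ m)⁻¹) *
        (1 / (2 * Real.pi) * (Real.exp (-ρ * τ) * (A τ)⁻¹)) := by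
    intro p τ hp hτ
    have hAp : 0 < A τ := hΛ.weightLaplace_pos hτ
    simp only [hJ, norm_mul, norm_real]
    rw [Real.norm_of_nonneg (Real.exp_pos (-2 * τ * p.2)).le,
      Real.norm_of_nonneg (by positivity : 0 ≤ 1 / (2 * Real.pi)),
      Real.norm_of_nonneg (Real.exp_pos (-ρ * τ)).le,
      Real.norm_of_nonneg (inv_pos.2 hAp).le]
    refine mul_le_mul_of_nonneg_right ?_ (by positivity)
    rw [mul_assoc ‖h _‖]
    refine (mul_le_of_le_one_right (norm_nonneg _) ?_).trans (hb p.1 p.2 hp.le)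
    rw [norm_exp, ← Real.exp_add]
    refine Real.exp_le_one_iff.2 ?_
    simp
    nlinarith [mul_pos hτ hp]
  have hJm : AEStronglyMeasurable (Function.uncurry J)
      ((volume.prod Λ).prod (volume.restrict (Ioi (0 : ℝ)))) := by
    have m1 : AEStronglyMeasurable (fun q : (ℝ × ℝ) × ℝ => h (q.1.1 + q.1.2 * I))
      ((volume.prod Λ).prod (volume.restrict (Ioi (0 : ℝ)))) := hhm.comp_fst
    have m2 : Measurable fun q : (ℝ × ℝ) × ℝ => A q.2 := hAm.comp measurable_snd
    have m3 : Measurable fun q : (ℝ × ℝ) × ℝ => cexp (-I * q.2 * (q.1.1 + q.1.2 * I)) := by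
      fun_prop
    have m4 : Measurable fun q : (ℝ × ℝ) × ℝ => ((Real.exp (-2 * q.2 * q.1.2) : ℝ) : ℂ) := by
      fun_prop
    have m5 : Measurable fun q : (ℝ × ℝ) × ℝ =>
        ((1 / (2 * Real.pi) * (Real.exp (-ρ * q.2) * (A q.2)⁻¹) : ℝ) : ℂ) := by fun_prop
    exact ((m1.mul m3.aestronglyMeasurable).mul m4.aestronglyMeasurable).mul m5.aestronglyMeasurable
  have hdom1 : Integrable (fun p : ℝ × ℝ => C * ((1 + p.1 ^ 2)⁻¹ * ((1 + p.2) ^ m)⁻¹))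
      (volume.prod Λ) := (integrable_inv_one_add_sq.mul_prod hΛm).const_mul C
  have hdom2 : Integrable (fun τ => 1 / (2 * Real.pi) * (Real.exp (-ρ * τ) * (A τ)⁻¹))
      (volume.restrict (Ioi 0)) := (hΛ.integrableOn_exp_mul_inv hρ).const_mul _
  have hτae : ∀ᵐ τ ∂(volume.restrict (Ioi (0 : ℝ))), 0 < τ := ae_restrict_mem measurableSet_Ioi
  have hJi : Integrable (Function.uncurry J)
      ((volume.prod Λ).prod (volume.restrict (Ioi (0 : ℝ)))) := by
    refine (hdom1.mul_prod hdom2).mono' hJm ?_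
    have h1 := (Measure.quasiMeasurePreserving_fst (μ := (volume : Measure ℝ).prod Λ)
      (ν := volume.restrict (Ioi (0 : ℝ)))).ae hpos
    have h2 := (Measure.quasiMeasurePreserving_snd (μ := (volume : Measure ℝ).prod Λ)
      (ν := volume.restrict (Ioi (0 : ℝ)))).ae hτae
    filter_upwards [h1, h2] with q hq1 hq2
    exact hJnorm q.1 q.2 hq1 hq2
  have hJτ : ∀ p : ℝ × ℝ, ∫ τ in Ioi 0, J p τ = h (p.1 + p.2 * I) *
      (starRingEnd ℂ) (halfPlaneKernel Λ (p.1 + p.2 * I + ρ * I)) := by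
    intro p
    rw [halfPlaneKernel, map_mul, ← integral_conj, ← integral_const_mul, ← integral_const_mul]
    refine integral_congr_ae (ae_of_all _ fun τ => ?_)
    simp only [hJ, map_mul, ← exp_conj, conj_I, conj_ofReal, map_add, map_div₀, map_one,
      map_ofNat]
    push_cast
    have : cexp (-I * (p.1 + p.2 * -I + ρ * -I) * τ) =
        cexp (-I * τ * (p.1 + p.2 * I)) * cexp (-2 * τ * p.2) * cexp (-ρ * τ) := by
      rw [← Complex.exp_add, ← Complex.exp_add]
      congr 1
      linear_combination (2 * (p.2 : ℂ) * τ + ρ * τ) * I_sq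
    rw [this]
    ring
  set H : ℝ → ℂ := fun τ => ∫ x : ℝ, h x * cexp (-I * τ * x) with hH
  -- The integral over the line at height `y` does not depend on `y`.
  have hshift : ∀ τ y : ℝ, 0 < τ → 0 < y →
      ∫ x : ℝ, h (x + y * I) * cexp (-I * τ * (x + y * I)) = H τ := by
    intro τ y hτ hy
    have hexpn : ∀ x u : ℝ, ‖cexp (-I * τ * (x + u * I))‖ = Real.exp (τ * u) := by
      intro x u
      rw [norm_exp]
      simp
    have hbd : ∀ x u : ℝ, 0 ≤ u → u ≤ y → ‖h (x + u * I) * cexp (-I * τ * (x + u * I))‖ ≤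
        C * Real.exp (τ * y) * (1 + x ^ 2)⁻¹ := by
      intro x u hu huy
      rw [norm_mul, hexpn]
      have h1 : ‖h (x + u * I)‖ ≤ C * (1 + x ^ 2)⁻¹ := by
        refine (hb x u hu).trans ?_
        gcongr
        refine mul_le_of_le_one_right (by positivity) (inv_le_one_of_one_le₀ ?_)
        exact one_le_pow₀ (by linarith)
      have h2 : Real.exp (τ * u) ≤ Real.exp (τ * y) := Real.exp_le_exp.2 (by gcongr)
      calc _ ≤ C * (1 + x ^ 2)⁻¹ * Real.exp (τ * y) := by gcongr
        _ = _ := by ring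
    have h_int : ∀ u : ℝ, 0 ≤ u → u ≤ y →
        Integrable fun x : ℝ => h (x + u * I) * cexp (-I * τ * (x + u * I)) := by
      intro u hu huy
      refine (integrable_inv_one_add_sq.const_mul (C * Real.exp (τ * y))).mono'
        ((hhx u hu).mul (by fun_prop)).aestronglyMeasurable (ae_of_all _ fun x => hbd x u hu huy)
    have := integral_horizontal_line_eq (q := fun z => h z * cexp (-I * τ * z)) (Y := y)
      (C := C * Real.exp (τ * y)) (X₀ := 1) hy.le ?_ ?_ ?_ (h_int y hy.le le_rfl)
    · exact this
    · refine (hd.mono fun z hz => ?_).mul (by fun_prop)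
      exact lt_of_lt_of_le (neg_lt_zero.2 ha) hz
    · intro x u hx hu huy
      refine (hbd x u hu huy).trans ?_
      rw [div_eq_mul_inv]
      have hx0 : 0 < x ^ 2 := by
        have : x ≠ 0 := by
          rintro rfl
          simp at hx
          linarith
        positivity
      gcongr
      linarith
    · have := h_int 0 le_rfl hy.le
      simpa using this
  -- Only `e^{-2τy}` is left to integrate against `Λ`; it yields `A τ`, which cancels the reciprocal
  -- in the kernel. The weight disappears from the formula.
  have hJp : ∀ τ ∈ Ioi (0 : ℝ), ∫ p, J p τ ∂(volume.prod Λ) =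
      1 / (2 * Real.pi) * (Real.exp (-ρ * τ) * H τ) := by
    intro τ hτ
    have hτ0 : 0 < τ := hτ
    have hi : Integrable (fun p => J p τ) (volume.prod Λ) := by
      refine (hdom1.mul_const (1 / (2 * Real.pi) * (Real.exp (-ρ * τ) * (A τ)⁻¹))).mono' ?_
        (hpos.mono fun p hp => hJnorm p τ hp hτ)
      have m3 : Continuous fun q : ℝ × ℝ => cexp (-I * τ * (q.1 + q.2 * I)) := by fun_prop
      have m4 : Continuous fun q : ℝ × ℝ => ((Real.exp (-2 * τ * q.2) : ℝ) : ℂ) := by fun_prop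
      exact ((hhm.mul m3.aestronglyMeasurable).mul m4.aestronglyMeasurable).mul
        aestronglyMeasurable_const
    rw [integral_prod_symm _ hi]
    have e1 : ∀ᵐ y ∂Λ, ∫ x : ℝ, J (x, y) τ = (Real.exp (-2 * τ * y) : ℝ) * (H τ *
        ((1 / (2 * Real.pi) * (Real.exp (-ρ * τ) * (A τ)⁻¹) : ℝ) : ℂ)) := by
      filter_upwards [hΛ.ae_pos] with y hy
      simp only [hJ]
      rw [integral_mul_const, integral_mul_const, hshift τ y hτ hy]
      ring
    rw [integral_congr_ae e1, integral_mul_const, integral_complex_ofReal]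
    change ((A τ : ℝ) : ℂ) * _ = _
    have hAp : (A τ : ℂ) ≠ 0 := by exact_mod_cast (hΛ.weightLaplace_pos hτ).ne'
    push_cast
    field_simp
  have step1 : ∫ p : ℝ × ℝ, h (p.1 + p.2 * I) *
      (starRingEnd ℂ) (halfPlaneKernel Λ (p.1 + p.2 * I + ρ * I)) ∂(volume.prod Λ) =
      ∫ τ in Ioi (0 : ℝ), 1 / (2 * Real.pi) * (Real.exp (-ρ * τ) * H τ) := by
    simp_rw [← hJτ]
    rw [integral_integral_swap hJi]
    exact setIntegral_congr_fun measurableSet_Ioi hJp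
  have hh0 : ∀ x : ℝ, ‖h x‖ ≤ C * (1 + x ^ 2)⁻¹ := by
    intro x
    have := hb x 0 le_rfl
    simpa using this
  have hh0c : Continuous fun x : ℝ => h x := by simpa using hhx 0 le_rfl
  have hexpi : IntegrableOn (fun τ => Real.exp (-ρ * τ)) (Ioi 0) :=
    integrableOn_exp_mul_Ioi (by linarith) 0
  have hfub : Integrable (Function.uncurry fun τ x : ℝ =>
      (Real.exp (-ρ * τ) : ℂ) * (h x * cexp (-I * τ * x)))
      ((volume.restrict (Ioi (0 : ℝ))).prod volume) := by
    refine (hexpi.mul_prod (integrable_inv_one_add_sq.const_mul C)).mono' ?_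
      (ae_of_all _ fun q => ?_)
    · have c1 : Continuous fun q : ℝ × ℝ => h q.2 := hh0c.comp continuous_snd
      have c2 : Continuous fun q : ℝ × ℝ => (Real.exp (-ρ * q.1) : ℂ) := by fun_prop
      have c3 : Continuous fun q : ℝ × ℝ => cexp (-I * q.1 * q.2) := by fun_prop
      exact (c2.mul (c1.mul c3)).aestronglyMeasurable
    · simp only [Function.uncurry, norm_mul]
      have : ‖cexp (-I * q.1 * q.2)‖ = 1 := by rw [norm_exp]; simp
      rw [this, mul_one, norm_real, Real.norm_of_nonneg (Real.exp_pos _).le]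
      gcongr
      exact hh0 q.2
  -- Integrating `e^{-(ρ + ix)τ}` over `τ > 0` produces the Cauchy kernel for the point `iρ`.
  have step2 : ∫ τ in Ioi (0 : ℝ), (Real.exp (-ρ * τ) : ℂ) * H τ =
      ∫ x : ℝ, h x / (ρ + I * x) := by
    simp_rw [hH, ← integral_const_mul]
    rw [integral_integral_swap hfub]
    refine integral_congr_ae (ae_of_all _ fun x => ?_)
    have e : ∀ τ : ℝ, (Real.exp (-ρ * τ) : ℂ) * (h x * cexp (-I * τ * x)) =
        h x * cexp (-(ρ + I * x) * τ) := by
      intro τ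
      have : cexp (-(ρ + I * x) * τ) = (Real.exp (-ρ * τ) : ℂ) * cexp (-I * τ * x) := by
        push_cast
        rw [← Complex.exp_add]; congr 1; ring
      rw [this]; ring
    simp_rw [e]
    rw [integral_const_mul, integral_exp_mul_complex_Ioi (by simpa using hρ)]
    simp only [ofReal_zero, mul_zero, Complex.exp_zero]
    rw [neg_div_neg_eq, mul_one_div]
  have hCauchy := integral_div_sub_eq_of_decay ha hρ hd (C := C) fun x y hy => by
    refine (hb x y hy).trans ?_
    gcongr
    exact le_self_pow₀ (by linarith) (by omega)
  rw [step1, integral_const_mul, step2, hCauchy]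
  have : (Real.pi : ℂ) ≠ 0 := by exact_mod_cast Real.pi_pos.ne'
  field_simp

lemma measurePreserving_exp_smul (θ : ℝ) :
    MeasurePreserving (fun z : ℂ => cexp (θ * I) * z) volume volume := by
  have e : (fun z : ℂ => cexp (θ * I) * z) = rotation (Circle.exp θ) := by
    ext z
    simp [rotation_apply, Circle.coe_exp]
  rw [e]
  exact (rotation (Circle.exp θ)).measurePreserving

/-- A holomorphic function is bounded by its `L²` norm over a disc. -/
lemma enorm_sq_mul_volume_ball_le {g : ℂ → ℂ} {c : ℂ} {r : ℝ}
    (hg : DifferentiableOn ℂ g (Metric.ball c r)) :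
    ‖g c‖ₑ ^ 2 * volume (Metric.ball (0 : ℂ) r) ≤ ∫⁻ z in Metric.ball c r, ‖g z‖ₑ ^ 2 := by
  have hT : Measurable (Function.uncurry fun (θ : ℝ) (z : ℂ) => cexp (θ * I) * z) := by
    unfold Function.uncurry; fun_prop
  have hmaps : MapsTo (fun z : ℂ => c + z) (Metric.ball 0 r) (Metric.ball c r) := by
    intro z hz
    simpa using hz
  have hgc : ContinuousOn (fun z => g (c + z)) (Metric.ball 0 r) :=
    hg.continuousOn.comp (by fun_prop) hmaps
  -- Rotations about the centre preserve the disc, so the averaging lemma applies with constant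
  -- central value `g c`.
  have h := lintegral_center_sq_le (μ := volume.restrict (Metric.ball (0 : ℂ) r))
    (T := fun θ z => cexp (θ * I) * z) (f := fun z => g (c + z)) (f₀ := fun _ => g c) hT
    (fun θ => ?_) (hgc.aestronglyMeasurable Metric.isOpen_ball.measurableSet) ?_
  · rw [setLIntegral_const] at h
    refine h.trans (le_of_eq ?_)
    have e := (measurePreserving_add_left (volume : Measure ℂ) c).setLIntegral_comp_preimage_emb
      (MeasurableEquiv.addLeft c).measurableEmbedding (fun z => ‖g z‖ₑ ^ 2) (Metric.ball c r)
    rw [← e]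
    congr 2
    ext z
    simp
  · have := (measurePreserving_exp_smul θ).restrict_preimage
      (Metric.isOpen_ball.measurableSet : MeasurableSet (Metric.ball (0 : ℂ) r))
    convert this using 2
    ext z
    simp [norm_exp]
  · refine (ae_restrict_iff' Metric.isOpen_ball.measurableSet).2 (ae_of_all _ fun z hz => ?_)
    refine ⟨fun ζ => g (c + ζ * z), ?_, by simp, fun θ => by simp [circleMap]⟩
    refine DifferentiableOn.diffContOnCl ?_
    rw [closure_ball _ one_ne_zero]
    refine hg.comp (by fun_prop) fun ζ hζ => ?_
    simp only [Metric.mem_closedBall, dist_zero_right, Metric.mem_ball] at hζ hz ⊢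
    rw [dist_self_add_left, norm_mul]
    exact lt_of_le_of_lt (mul_le_of_le_one_left (norm_nonneg _) hζ) hz

section

variable {Λ : Measure ℝ}

lemma IsHalfPlaneWeight.ae_prod_pos [SFinite Λ] (hΛ : IsHalfPlaneWeight Λ) :
    ∀ᵐ p : ℝ × ℝ ∂((volume : Measure ℝ).prod Λ), 0 < p.2 :=
  (Measure.quasiMeasurePreserving_snd (μ := (volume : Measure ℝ)) (ν := Λ)).ae hΛ.ae_pos

/-- Functions of the weighted Bergman space are bounded away from the boundary. -/
lemma IsHalfPlaneWeight.exists_norm_le [SFinite Λ] (hΛ : IsHalfPlaneWeight Λ) {g : ℂ → ℂ}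
    (hg : DifferentiableOn ℂ g {z | 0 < z.im})
    (hg2 : MemLp (fun p : ℝ × ℝ => g (p.1 + p.2 * I)) 2 (volume.prod Λ)) {ε : ℝ} (hε : 0 < ε) :
    ∃ C : ℝ, 0 ≤ C ∧ ∀ z : ℂ, ε ≤ z.im → ‖g z‖ ≤ C := by
  -- A disc of radius `ε/2` about a point of height at least `ε` stays above height `ε/2`, where `Λ`
  -- dominates `c` times Lebesgue measure.
  obtain ⟨c, hc0, hct, hc⟩ := hΛ.lower (ε / 2) (by positivity)
  have hopen : IsOpen {z : ℂ | 0 < z.im} := isOpen_lt continuous_const continuous_im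
  set G : ℂ → ENNReal := {z : ℂ | 0 < z.im}.indicator fun z => ‖g z‖ₑ ^ 2 with hG
  have hGm : Measurable G := by
    have h1 : Measurable ({z : ℂ | 0 < z.im}.indicator g) := by
      classical
      exact hg.continuousOn.measurable_piecewise continuousOn_const hopen.measurableSet
    have h2 : G = fun z => ‖{z : ℂ | 0 < z.im}.indicator g z‖ₑ ^ 2 := by
      ext z
      by_cases hz : z ∈ {z : ℂ | 0 < z.im} <;> simp [hG, hz]
    rw [h2]
    fun_prop
  set N : ENNReal := ∫⁻ p : ℝ × ℝ, ‖g (p.1 + p.2 * I)‖ₑ ^ 2 ∂(volume.prod Λ) with hN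
  have hNt : N ≠ ⊤ := by
    have h1 := ((memLp_two_iff_integrable_sq_norm hg2.1).1 hg2).2
    rw [hasFiniteIntegral_iff_enorm] at h1
    simp only [enorm_pow, enorm_norm] at h1
    exact h1.ne
  have hballN : ∀ z : ℂ, ε ≤ z.im →
      c * ∫⁻ w in Metric.ball z (ε / 2), ‖g w‖ₑ ^ 2 ≤ N := by
    intro z hz
    have him : ∀ w ∈ Metric.ball z (ε / 2), ε / 2 < w.im := by
      intro w hw
      have h1 : |(w - z).im| ≤ ‖w - z‖ := abs_im_le_norm _
      rw [Metric.mem_ball, dist_eq] at hw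
      rw [sub_im] at h1
      have := (abs_lt.1 (h1.trans_lt hw)).1
      linarith
    have e1 : ∫⁻ w in Metric.ball z (ε / 2), ‖g w‖ₑ ^ 2 ≤
        ∫⁻ w, {w : ℂ | ε / 2 < w.im}.indicator G w := by
      rw [← lintegral_indicator Metric.isOpen_ball.measurableSet]
      refine lintegral_mono fun w => ?_
      by_cases hw : w ∈ Metric.ball z (ε / 2)
      · have h1 := him w hw
        have h2 : w ∈ {w : ℂ | ε / 2 < w.im} := h1
        have h3 : w ∈ {w : ℂ | 0 < w.im} := (by positivity : 0 < ε / 2).trans h1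
        rw [indicator_of_mem hw, indicator_of_mem h2, hG, indicator_of_mem h3]
      · rw [indicator_of_notMem hw]
        exact zero_le
    have e2 : ∫⁻ w, {w : ℂ | ε / 2 < w.im}.indicator G w =
        ∫⁻ x : ℝ, ∫⁻ y in Ioi (ε / 2), G (x + y * I) := by
      have hm : Measurable ({w : ℂ | ε / 2 < w.im}.indicator G) :=
        hGm.indicator (measurableSet_lt measurable_const measurable_im)
      rw [← (volume_preserving_equiv_real_prod.symm).lintegral_comp hm, Measure.volume_eq_prod,
        lintegral_prod _ (by
          exact (hm.comp measurableEquivRealProd.symm.measurable).aemeasurable)]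
      refine lintegral_congr fun x => ?_
      rw [← lintegral_indicator measurableSet_Ioi]
      refine lintegral_congr fun y => ?_
      have e : measurableEquivRealProd.symm (x, y) = (x + y * I : ℂ) := by
        apply Complex.ext <;> simp [measurableEquivRealProd]
      rw [e]
      by_cases hy : y ∈ Ioi (ε / 2)
      · rw [indicator_of_mem hy, indicator_of_mem]
        simpa using hy
      · rw [indicator_of_notMem hy, indicator_of_notMem]
        simpa using hy
    have e3 : c * ∫⁻ x : ℝ, ∫⁻ y in Ioi (ε / 2), G (x + y * I) ≤
        ∫⁻ x : ℝ, ∫⁻ y, G (x + y * I) ∂Λ := by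
      rw [← lintegral_const_mul' _ _ hct]
      refine lintegral_mono fun x => ?_
      rw [← smul_eq_mul, ← lintegral_smul_measure]
      exact lintegral_mono' hc le_rfl
    have e4 : ∫⁻ x : ℝ, ∫⁻ y, G (x + y * I) ∂Λ = N := by
      have hm : Measurable fun p : ℝ × ℝ => G (p.1 + p.2 * I) := hGm.comp (by fun_prop)
      have := lintegral_prod (μ := (volume : Measure ℝ)) (ν := Λ) _ hm.aemeasurable
      rw [← this, hN]
      refine lintegral_congr_ae ?_
      filter_upwards [hΛ.ae_prod_pos] with p hp
      rw [hG, indicator_of_mem]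
      simpa using hp
    calc _ ≤ c * ∫⁻ w, {w : ℂ | ε / 2 < w.im}.indicator G w := by gcongr
      _ ≤ N := by rw [e2, ← e4]; exact e3
  set V : ENNReal := volume (Metric.ball (0 : ℂ) (ε / 2)) with hV
  have hV0 : V ≠ 0 := (Metric.measure_ball_pos _ _ (by positivity)).ne'
  have hVt : V ≠ ⊤ := measure_ball_lt_top.ne
  have hfin : N / (c * V) ≠ ⊤ := ENNReal.div_ne_top hNt (mul_ne_zero hc0 hV0)
  refine ⟨√(N / (c * V)).toReal, Real.sqrt_nonneg _, fun z hz => ?_⟩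
  have h1 : ‖g z‖ₑ ^ 2 ≤ N / (c * V) := by
    rw [ENNReal.le_div_iff_mul_le (Or.inl (mul_ne_zero hc0 hV0))
      (Or.inl (ENNReal.mul_ne_top hct hVt))]
    have hz' : DifferentiableOn ℂ g (Metric.ball z (ε / 2)) := by
      refine hg.mono fun w hw => ?_
      have h1 : |(w - z).im| ≤ ‖w - z‖ := abs_im_le_norm _
      rw [Metric.mem_ball, dist_eq] at hw
      rw [sub_im] at h1
      have := (abs_lt.1 (h1.trans_lt hw)).1
      change 0 < w.im
      linarith
    calc ‖g z‖ₑ ^ 2 * (c * V) = c * (‖g z‖ₑ ^ 2 * V) := by ring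
      _ ≤ c * ∫⁻ w in Metric.ball z (ε / 2), ‖g w‖ₑ ^ 2 := by
        gcongr
        exact enorm_sq_mul_volume_ball_le hz'
      _ ≤ N := hballN z hz
  refine Real.le_sqrt_of_sq_le ?_
  rw [← ENNReal.ofReal_le_iff_le_toReal hfin, ENNReal.ofReal_pow (norm_nonneg _), ofReal_norm]
  exact h1

/-- These bounds make powers of `(1 - iεz)⁻¹` a damping factor: of modulus at most `1` on the half
plane, and decaying in both `x` and `y`. -/
lemma norm_one_sub_I_mul_ge {ε x y : ℝ} (hε : 0 < ε) (hε1 : ε ≤ 1) (hy : 0 ≤ y) :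
    1 ≤ ‖1 - I * ε * (x + y * I)‖ ∧ ε * (1 + y) ≤ ‖1 - I * ε * (x + y * I)‖ ∧
      ε ^ 2 * (1 + x ^ 2) ≤ ‖1 - I * ε * (x + y * I)‖ ^ 2 := by
  have hre : (1 - I * ε * (x + y * I) : ℂ).re = 1 + ε * y := by
    simp
  have him : (1 - I * ε * (x + y * I) : ℂ).im = -(ε * x) := by
    simp
  have h1 : 1 + ε * y ≤ ‖1 - I * ε * (x + y * I)‖ := by
    rw [← hre]; exact re_le_norm _
  have h2 : 0 ≤ ε * y := by positivity
  refine ⟨by linarith, by nlinarith, ?_⟩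
  rw [← normSq_eq_norm_sq, normSq_apply, hre, him]
  nlinarith [mul_nonneg h2 h2]

/-- The reproducing property of the kernel of the weighted Bergman space of the half plane. -/
theorem IsHalfPlaneWeight.integral_mul_conj_kernel [SFinite Λ] (hΛ : IsHalfPlaneWeight Λ)
    {g : ℂ → ℂ} (hg : DifferentiableOn ℂ g {z | 0 < z.im})
    (hg2 : MemLp (fun p : ℝ × ℝ => g (p.1 + p.2 * I)) 2 (volume.prod Λ)) {ρ : ℝ} (hρ : 0 < ρ) :
    ∫ p : ℝ × ℝ, g (p.1 + p.2 * I) *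
      (starRingEnd ℂ) (halfPlaneKernel Λ (p.1 + p.2 * I + ρ * I)) ∂(volume.prod Λ) =
      g (I * ρ) := by
  obtain ⟨m₀, hm₀⟩ := hΛ.decay
  -- The reproducing property for decaying functions needs a decay exponent of at least `1`.
  set m := m₀ + 1 with hmdef
  have hm : Integrable (fun y : ℝ => ((1 + y) ^ m)⁻¹) Λ := by
    refine hm₀.mono' (by fun_prop) (hΛ.ae_pos.mono fun y hy => ?_)
    rw [Real.norm_of_nonneg (by positivity)]
    gcongr
    · linarith
    · omega
  set e : ℕ → ℝ := fun n => 1 / ((n : ℝ) + 1) with he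
  have he0 : ∀ n, 0 < e n := fun n => by positivity
  have he1 : ∀ n, e n ≤ 1 := fun n => by
    rw [he]
    simp only
    rw [div_le_one (by positivity)]
    linarith [(Nat.cast_nonneg n : (0 : ℝ) ≤ n)]
  have helim : Tendsto e atTop (𝓝 0) := tendsto_one_div_add_atTop_nhds_zero_nat
  -- The upward shift makes `g` bounded and holomorphic across the real line. Of the `m + 2` damping
  -- factors, two give decay in `x` and `m` give decay in `y`.
  set h : ℕ → ℂ → ℂ := fun n z => g (z + e n * I) * ((1 - I * e n * z) ^ (m + 2))⁻¹ with hh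
  have hopen : IsOpen {z : ℂ | 0 < z.im} := isOpen_lt continuous_const continuous_im
  have hne : ∀ n (z : ℂ), -(e n) < z.im → 1 - I * e n * z ≠ 0 := by
    intro n z hz h0
    have := congrArg Complex.re h0
    simp at this
    nlinarith [he0 n, he1 n]
  have hrep : ∀ n, ∫ p : ℝ × ℝ, h n (p.1 + p.2 * I) *
      (starRingEnd ℂ) (halfPlaneKernel Λ (p.1 + p.2 * I + ρ * I)) ∂(volume.prod Λ) =
      h n (I * ρ) := by
    intro n
    obtain ⟨C, hC0, hC⟩ := hΛ.exists_norm_le hg hg2 (he0 n)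
    refine hΛ.integral_mul_conj_kernel_of_decay (a := e n) (C := C * ((e n) ^ (m + 2))⁻¹)
      (he0 n) hρ (m := m) (by omega) hm ?_ ?_
    · refine DifferentiableOn.mul (hg.comp (by fun_prop) fun z hz => ?_) ?_
      · have : -(e n) < z.im := hz
        simp
        linarith
      · exact DifferentiableOn.inv (by fun_prop) fun z hz => pow_ne_zero _ (hne n z hz)
    · intro x y hy
      obtain ⟨b1, b2, b3⟩ := norm_one_sub_I_mul_ge (x := x) (he0 n) (he1 n) hy
      have hp := he0 n
      rw [hh]
      simp only [norm_mul, norm_inv, norm_pow]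
      have h1 : ‖g (x + y * I + e n * I)‖ ≤ C := hC _ (by simp; linarith)
      have h2 : (‖1 - I * e n * (x + y * I)‖ ^ (m + 2))⁻¹ ≤
          ((e n) ^ (m + 2))⁻¹ * ((1 + x ^ 2)⁻¹ * ((1 + y) ^ m)⁻¹) := by
        rw [← mul_inv, ← mul_inv]
        refine inv_anti₀ (by positivity) ?_
        calc (e n) ^ (m + 2) * ((1 + x ^ 2) * (1 + y) ^ m)
            = (e n * (1 + y)) ^ m * ((e n) ^ 2 * (1 + x ^ 2)) := by
              rw [mul_pow]; ring
          _ ≤ ‖1 - I * e n * (x + y * I)‖ ^ m * ‖1 - I * e n * (x + y * I)‖ ^ 2 := by gcongr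
          _ = _ := (pow_add _ _ _).symm
      calc _ ≤ C * (((e n) ^ (m + 2))⁻¹ * ((1 + x ^ 2)⁻¹ * ((1 + y) ^ m)⁻¹)) := by gcongr
        _ = _ := by ring
  have hgn : ∀ n, AEStronglyMeasurable (fun p : ℝ × ℝ => h n (p.1 + p.2 * I)) (volume.prod Λ) := by
    intro n
    have hc : ContinuousOn (fun p : ℝ × ℝ => h n (p.1 + p.2 * I)) {p | 0 < p.2} := by
      refine ContinuousOn.mul (hg.continuousOn.comp (by fun_prop) fun p hp => ?_) ?_
      · have : 0 < p.2 := hp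
        have := he0 n
        simp
        linarith
      · refine ContinuousOn.inv₀ (by fun_prop) fun p hp => pow_ne_zero _ (hne n _ ?_)
        have : 0 < p.2 := hp
        have := he0 n
        simp
        linarith
    rw [← Measure.restrict_eq_self_of_ae_mem hΛ.ae_prod_pos]
    exact hc.aestronglyMeasurable (isOpen_lt continuous_const continuous_snd).measurableSet
  have hg2i := (memLp_two_iff_integrable_sq_norm hg2.1).1 hg2
  -- Damping does not increase the modulus, and shifting does not increase the norm because `Λ.map
  -- (· + ε) ≤ Λ`.
  have hle : ∀ n, ∫⁻ p : ℝ × ℝ, ENNReal.ofReal (‖h n (p.1 + p.2 * I)‖ ^ 2) ∂(volume.prod Λ) ≤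
      ∫⁻ p : ℝ × ℝ, ENNReal.ofReal (‖g (p.1 + p.2 * I)‖ ^ 2) ∂(volume.prod Λ) := by
    intro n
    set G : ℂ → ENNReal := {z : ℂ | 0 < z.im}.indicator fun z => ENNReal.ofReal (‖g z‖ ^ 2) with hG
    have hGm : Measurable G := by
      have h1 : Measurable ({z : ℂ | 0 < z.im}.indicator g) := by
        classical
        exact hg.continuousOn.measurable_piecewise continuousOn_const hopen.measurableSet
      have h2 : G = fun z => ENNReal.ofReal (‖{z : ℂ | 0 < z.im}.indicator g z‖ ^ 2) := by
        ext z
        by_cases hz : z ∈ {z : ℂ | 0 < z.im} <;> simp [hG, hz]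
      rw [h2]
      fun_prop
    have hGp : Measurable fun p : ℝ × ℝ => G (p.1 + p.2 * I) := hGm.comp (by fun_prop)
    have hGp' : Measurable fun p : ℝ × ℝ => G (p.1 + (p.2 + e n : ℝ) * I) :=
      hGm.comp (by fun_prop)
    calc ∫⁻ p : ℝ × ℝ, ENNReal.ofReal (‖h n (p.1 + p.2 * I)‖ ^ 2) ∂(volume.prod Λ)
        ≤ ∫⁻ p : ℝ × ℝ, G (p.1 + (p.2 + e n : ℝ) * I) ∂(volume.prod Λ) := by
          refine lintegral_mono_ae ?_
          filter_upwards [hΛ.ae_prod_pos] with p hp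
          have hpe := he0 n
          rw [hG, indicator_of_mem (by simp; linarith)]
          refine ENNReal.ofReal_le_ofReal ?_
          obtain ⟨b1, -, -⟩ := norm_one_sub_I_mul_ge (x := p.1) (he0 n) (he1 n) hp.le
          have e1 : (p.1 + (p.2 + e n : ℝ) * I : ℂ) = p.1 + p.2 * I + e n * I := by
            push_cast; ring
          rw [e1, hh]
          simp only [norm_mul, norm_inv, norm_pow]
          gcongr
          exact mul_le_of_le_one_right (norm_nonneg _) (inv_le_one_of_one_le₀ (one_le_pow₀ b1))
      _ = ∫⁻ x : ℝ, ∫⁻ y, G (x + (y + e n : ℝ) * I) ∂Λ := lintegral_prod _ hGp'.aemeasurable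
      _ ≤ ∫⁻ x : ℝ, ∫⁻ y, G (x + y * I) ∂Λ := by
          refine lintegral_mono fun x => ?_
          have hGx : Measurable fun y : ℝ => G (x + y * I) := hGm.comp (by fun_prop)
          have e1 := lintegral_map hGx (measurable_add_const (e n)) (μ := Λ)
          rw [← e1]
          exact lintegral_mono' (hΛ.shift _ (he0 n)) le_rfl
      _ = ∫⁻ p : ℝ × ℝ, G (p.1 + p.2 * I) ∂(volume.prod Λ) :=
          (lintegral_prod _ hGp.aemeasurable).symm
      _ = _ := by
          refine lintegral_congr_ae ?_
          filter_upwards [hΛ.ae_prod_pos] with p hp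
          rw [hG, indicator_of_mem]
          simpa using hp
  have hgfin : ∫⁻ p : ℝ × ℝ, ENNReal.ofReal (‖g (p.1 + p.2 * I)‖ ^ 2) ∂(volume.prod Λ) < ⊤ :=
    hg2i.lintegral_lt_top
  have hhi : ∀ n, Integrable (fun p : ℝ × ℝ => ‖h n (p.1 + p.2 * I)‖ ^ 2) (volume.prod Λ) := by
    intro n
    refine ⟨(hgn n).norm.pow 2, ?_⟩
    rw [hasFiniteIntegral_iff_ofReal (ae_of_all _ fun p => sq_nonneg _)]
    exact (hle n).trans_lt hgfin
  have hptw : ∀ z : ℂ, 0 < z.im → Tendsto (fun n => h n z) atTop (𝓝 (g z)) := by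
    intro z hz
    have hgz : ContinuousAt g z := hg.continuousOn.continuousAt (hopen.mem_nhds hz)
    have hec : Tendsto (fun n => (e n : ℂ)) atTop (𝓝 0) := by
      have := (continuous_ofReal.tendsto 0).comp helim
      rwa [ofReal_zero] at this
    have t1 : Tendsto (fun n => z + e n * I) atTop (𝓝 z) := by
      simpa using (hec.mul_const I).const_add z
    have t2 : Tendsto (fun n => ((1 - I * e n * z) ^ (m + 2))⁻¹) atTop (𝓝 1) := by
      have : Tendsto (fun n => 1 - I * e n * z) atTop (𝓝 1) := by
        simpa using ((hec.const_mul I).mul_const z).const_sub 1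
      simpa using (this.pow (m + 2)).inv₀ (by simp)
    simpa using (hgz.tendsto.comp t1).mul t2
  -- Weak convergence suffices to pass to the limit in the pairing with the fixed kernel.
  have hlim := tendsto_integral_mul_of_norm_le
    (G := fun n (p : ℝ × ℝ) => h n (p.1 + p.2 * I)) (g := fun p : ℝ × ℝ => g (p.1 + p.2 * I))
    (k := fun p : ℝ × ℝ => (starRingEnd ℂ) (halfPlaneKernel Λ (p.1 + p.2 * I + ρ * I)))
    (μ := volume.prod Λ)
    (fun n => (memLp_two_iff_integrable_sq_norm (hgn n)).2 (hhi n)) hg2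
    (hΛ.memLp_halfPlaneKernel hρ).star (fun n => ?_) ?_
  · simp_rw [hrep] at hlim
    refine tendsto_nhds_unique hlim ?_
    exact hptw (I * ρ) (by simpa using hρ)
  · rw [integral_eq_lintegral_of_nonneg_ae (ae_of_all _ fun p => sq_nonneg _) (hhi n).1,
      integral_eq_lintegral_of_nonneg_ae (ae_of_all _ fun p => sq_nonneg _) hg2i.1]
    exact ENNReal.toReal_mono hgfin.ne (hle n)
  · filter_upwards [hΛ.ae_prod_pos] with p hp
    exact hptw (p.1 + p.2 * I) (by simpa using hp)

end

/-! ### The function `F` and its sublevel sets -/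

section EuclNorm

variable {K : Type*} [NormedField K] {n : ℕ}

lemma continuous_euclNorm : Continuous (euclNorm : (Fin n → K) → ℝ) := by
  unfold euclNorm
  fun_prop

lemma euclNorm_nonneg (z : Fin n → K) : 0 ≤ euclNorm z := Real.sqrt_nonneg _

lemma norm_apply_le_euclNorm (z : Fin n → K) (j : Fin n) : ‖z j‖ ≤ euclNorm z := by
  refine Real.le_sqrt_of_sq_le ?_
  exact Finset.single_le_sum (f := fun i => ‖z i‖ ^ 2) (fun i _ => sq_nonneg _) (Finset.mem_univ j)

lemma norm_le_euclNorm (z : Fin n → K) : ‖z‖ ≤ euclNorm z :=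
  (pi_norm_le_iff_of_nonneg (euclNorm_nonneg z)).2 (norm_apply_le_euclNorm z)

lemma euclNorm_smul (c : K) (z : Fin n → K) : euclNorm (c • z) = ‖c‖ * euclNorm z := by
  unfold euclNorm
  rw [← Real.sqrt_sq (norm_nonneg c), ← Real.sqrt_mul (sq_nonneg _), Finset.mul_sum]
  simp [mul_pow]

lemma euclNorm_zero : euclNorm (0 : Fin n → K) = 0 := by simp [euclNorm]

lemma isOpen_euclBall (R : ℝ) : IsOpen (euclBall K n R) :=
  isOpen_lt continuous_euclNorm continuous_const

end EuclNorm

section Model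

variable {n : ℕ} {U : Set (Fin n → ℂ)} {F : (Fin n → ℂ) → ℝ}

lemma IsCompleteReinhardtDomain.zero_mem (hU : IsCompleteReinhardtDomain U) : 0 ∈ U := by
  obtain ⟨z, hz⟩ := hU.nonempty
  exact hU.complete z hz 0 fun j => by simp

lemma IsCompleteReinhardtDomain.smul_mem (hU : IsCompleteReinhardtDomain U) {z : Fin n → ℂ}
    (hz : z ∈ U) {ζ : ℂ} (hζ : ‖ζ‖ ≤ 1) : ζ • z ∈ U := by
  refine hU.complete z hz _ fun j => ?_
  rw [Pi.smul_apply, norm_smul]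
  exact mul_le_of_le_one_left (norm_nonneg _) hζ

lemma SatisfiesABCD.apply_smul_eq (hU : IsCompleteReinhardtDomain U) (hF : SatisfiesABCD U F)
    {z : Fin n → ℂ} (hz : z ∈ U) {ζ : ℂ} (hζ : ‖ζ‖ ≤ 1) : F (ζ • z) = F ((‖ζ‖ : ℂ) • z) := by
  have h1 : (‖ζ‖ : ℂ) • z ∈ U := hU.smul_mem hz (by simpa using hζ)
  rw [← hF.rotation_invariant _ h1 fun _ => ζ.arg]
  congr 1
  ext j
  simp only [Pi.smul_apply, smul_eq_mul]
  conv_lhs => rw [← norm_mul_exp_arg_mul_I ζ]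
  rw [mul_comm I]
  ring

/-- `F` is constant on the circle of all `ζ • z` with `|ζ| = 1`, so the sub-mean value inequality at
the origin reads `0 = F 0 ≤ F z`. -/
lemma SatisfiesABCD.nonneg (hU : IsCompleteReinhardtDomain U) (hF : SatisfiesABCD U F)
    {z : Fin n → ℂ} (hz : z ∈ U) : 0 ≤ F z := by
  have h := hF.psh.2 0 hU.zero_mem z fun ζ hζ => by simpa using hU.smul_mem hz hζ
  rw [(hF.zero_iff 0 hU.zero_mem).2 rfl] at h
  refine h.trans (le_of_eq ?_)
  refine Real.circleAverage_const_on_circle fun ζ hζ => ?_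
  have h1 : ‖ζ‖ = 1 := by simpa using hζ
  rw [zero_add, hF.apply_smul_eq hU hz h1.le, h1]
  simp

lemma SatisfiesABCD.continuous_apply_smul (hU : IsCompleteReinhardtDomain U)
    (hF : SatisfiesABCD U F) {z : Fin n → ℂ} (hz : z ∈ U) :
    ContinuousOn (fun ζ : ℂ => F (ζ • z)) (Metric.closedBall 0 1) :=
  hF.psh.1.comp (by fun_prop) fun ζ hζ => hU.smul_mem hz (by simpa using hζ)

/-- `F` is nondecreasing along rays (the maximum principle). -/
lemma SatisfiesABCD.apply_smul_le (hU : IsCompleteReinhardtDomain U) (hF : SatisfiesABCD U F)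
    {z : Fin n → ℂ} (hz : z ∈ U) {ζ : ℂ} (hζ : ‖ζ‖ ≤ 1) : F (ζ • z) ≤ F z := by
  set u : ℝ → ℝ := fun s => F ((s : ℂ) • z) with hu
  have huc : ContinuousOn u (Icc 0 1) := by
    refine (hF.continuous_apply_smul hU hz).comp (by fun_prop) fun s hs => ?_
    simpa [abs_of_nonneg hs.1] using hs.2
  obtain ⟨s₁, hs₁, hmax⟩ := isCompact_Icc.exists_isMaxOn (nonempty_Icc.2 zero_le_one) huc
  set M := u s₁ with hM
  have hle : ∀ ξ : ℂ, ‖ξ‖ ≤ 1 → F (ξ • z) ≤ M := by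
    intro ξ hξ
    rw [hF.apply_smul_eq hU hz hξ]
    exact hmax ⟨norm_nonneg ξ, hξ⟩
  have hTc : IsCompact (Icc 0 1 ∩ u ⁻¹' {M}) :=
    isCompact_Icc.of_isClosed_subset
      (huc.preimage_isClosed_of_isClosed isClosed_Icc isClosed_singleton) inter_subset_left
  -- `s` is the last parameter at which the maximum along the ray is attained. If `s < 1`, the
  -- circle about `s • z` through `z` has values at most `M`, with strict inequality at `z`,
  -- contradicting the sub-mean value inequality.
  obtain ⟨s, ⟨hs, hsM⟩, hsmax⟩ := hTc.exists_isGreatest ⟨s₁, hs₁, rfl⟩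
  have hsM' : u s = M := hsM
  by_cases hs1 : s = 1
  · have h1 : F z = M := by rw [← hsM', hs1, hu]; simp
    rw [h1]
    exact hle ζ hζ
  exfalso
  have hslt : s < 1 := lt_of_le_of_ne hs.2 hs1
  have hmem : ∀ ξ : ℂ, ‖ξ‖ ≤ 1 → ‖(s : ℂ) + ξ * (1 - s : ℝ)‖ ≤ 1 := by
    intro ξ hξ
    refine (norm_add_le _ _).trans ?_
    rw [norm_mul, norm_real, norm_real, Real.norm_of_nonneg hs.1,
      Real.norm_of_nonneg (by linarith : 0 ≤ 1 - s)]
    nlinarith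
  have hpt : ∀ ξ : ℂ, (s : ℂ) • z + ξ • (((1 - s : ℝ) : ℂ) • z) =
      ((s : ℂ) + ξ * (1 - s : ℝ)) • z := by
    intro ξ
    rw [add_smul, mul_smul]
  have hpsh := hF.psh.2 ((s : ℂ) • z) (hU.smul_mem hz (by simpa [abs_of_nonneg hs.1] using hs.2))
    (((1 - s : ℝ) : ℂ) • z) fun ξ hξ => by
      rw [hpt]
      exact hU.smul_mem hz (hmem ξ hξ)
  have hcirc : ∀ θ : ℝ, ‖circleMap 0 1 θ‖ ≤ 1 := fun θ => by simp
  simp_rw [hpt] at hpsh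
  rw [Real.circleAverage_def] at hpsh
  have hlt : ∫ θ in (0 : ℝ)..2 * Real.pi, F (((s : ℂ) + circleMap 0 1 θ * (1 - s : ℝ)) • z) <
      ∫ θ in (0 : ℝ)..2 * Real.pi, M := by
    refine intervalIntegral.integral_lt_integral_of_continuousOn_of_le_of_exists_lt
      (by positivity) ?_ continuousOn_const (fun θ _ => hle _ (hmem _ (hcirc θ)))
      ⟨0, ⟨le_rfl, by positivity⟩, ?_⟩
    · refine (hF.continuous_apply_smul hU hz).comp (by fun_prop) fun θ _ => ?_
      simpa using hmem _ (hcirc θ)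
    · have e : ((s : ℂ) + circleMap 0 1 0 * (1 - s : ℝ)) = ((1 : ℝ) : ℂ) := by
        simp [circleMap]
      rw [e]
      refine lt_of_le_of_ne (hle _ (by simp)) fun h1 => ?_
      have := hsmax ⟨⟨zero_le_one, le_rfl⟩, (h1 : u 1 = M)⟩
      linarith
  rw [intervalIntegral.integral_const, sub_zero, smul_eq_mul] at hlt
  have h2 : (2 * Real.pi)⁻¹ • ∫ θ in (0 : ℝ)..2 * Real.pi,
      F (((s : ℂ) + circleMap 0 1 θ * (1 - s : ℝ)) • z) < M := by
    rw [smul_eq_mul, inv_mul_lt_iff₀ (by positivity)]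
    exact hlt
  exact absurd (hpsh.trans_lt h2) (by rw [← hsM']; exact lt_irrefl _)

/-- A point outside the ball is contracted radially to the sphere of radius `r`. This does not
increase `F`, and `F` has a positive minimum on the compact sphere. -/
lemma SatisfiesABCD.exists_pos_le (hU : IsCompleteReinhardtDomain U) (hF : SatisfiesABCD U F)
    {r R : ℝ} (hr : 0 < r) (hrR : r < R) (hRU : euclBall ℂ n R ⊆ U) :
    ∃ m : ℝ, 0 < m ∧ ∀ z ∈ U, z ∉ euclBall ℂ n r → m ≤ F z := by
  set S : Set (Fin n → ℂ) := {z | euclNorm z = r} with hS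
  have hSU : S ⊆ U := fun z hz => hRU (by
    have : euclNorm z = r := hz
    change euclNorm z < R
    linarith)
  have hSc : IsCompact S := by
    refine (isCompact_closedBall (0 : Fin n → ℂ) r).of_isClosed_subset
      (isClosed_eq continuous_euclNorm continuous_const) fun z hz => ?_
    have : euclNorm z = r := hz
    rw [mem_closedBall_zero_iff, ← this]
    exact norm_le_euclNorm z
  have hproj : ∀ z, z ∉ euclBall ℂ n r → ‖((r / euclNorm z : ℝ) : ℂ)‖ ≤ 1 ∧
      ((r / euclNorm z : ℝ) : ℂ) • z ∈ S := by
    intro z hz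
    have h1 : r ≤ euclNorm z := not_lt.1 hz
    have h2 : 0 < euclNorm z := hr.trans_le h1
    have h3 : ‖((r / euclNorm z : ℝ) : ℂ)‖ = r / euclNorm z := by
      rw [norm_real, Real.norm_of_nonneg (by positivity)]
    refine ⟨by rw [h3, div_le_one h2]; exact h1, ?_⟩
    change euclNorm _ = r
    rw [euclNorm_smul, h3]
    field_simp
  rcases S.eq_empty_or_nonempty with hemp | hne
  -- The sphere is empty only for `n = 0`; then no point lies outside the ball and any positive
  -- constant serves.
  · refine ⟨1, one_pos, fun z _ hz => ?_⟩
    have := (hproj z hz).2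
    rw [hemp] at this
    exact this.elim
  · obtain ⟨w, hw, hmin⟩ := hSc.exists_isMinOn hne (hF.psh.1.mono hSU)
    refine ⟨F w, ?_, fun z hzU hz => ?_⟩
    · refine lt_of_le_of_ne (hF.nonneg hU (hSU hw)) fun h0 => ?_
      have h1 := (hF.zero_iff w (hSU hw)).1 h0.symm
      have h2 : euclNorm w = r := hw
      rw [h1, euclNorm_zero] at h2
      exact hr.ne h2
    · obtain ⟨h1, h2⟩ := hproj z hz
      exact (hmin h2).trans (hF.apply_smul_le hU hzU h1)

/-- The volume of the sublevel sets of `F`. -/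
def sublevelVolume (U : Set (Fin n → ℂ)) (F : (Fin n → ℂ) → ℝ) (y : ℝ) : ENNReal :=
  volume {z | z ∈ U ∧ F z < y}

lemma monotone_sublevelVolume : Monotone (sublevelVolume U F) := fun _ _ hxy =>
  measure_mono fun _ hz => ⟨hz.1, hz.2.trans_le hxy⟩

lemma SatisfiesABCD.sublevelVolume_eq_zero (hU : IsCompleteReinhardtDomain U)
    (hF : SatisfiesABCD U F) {y : ℝ} (hy : y ≤ 0) : sublevelVolume U F y = 0 := by
  have : {z | z ∈ U ∧ F z < y} = ∅ := by
    ext z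
    simp only [mem_ofPred_eq, mem_empty_iff_false, iff_false, not_and, not_lt]
    exact fun hz => hy.trans (hF.nonneg hU hz)
  rw [sublevelVolume, this, measure_empty]

lemma SatisfiesABCD.sublevelVolume_ne_zero (hU : IsCompleteReinhardtDomain U)
    (hF : SatisfiesABCD U F) {y : ℝ} (hy : 0 < y) : sublevelVolume U F y ≠ 0 := by
  have ho : IsOpen {z | z ∈ U ∧ F z < y} := hF.psh.1.isOpen_inter_preimage hU.isOpen isOpen_Iio
  refine (ho.measure_pos volume ⟨0, hU.zero_mem, ?_⟩).ne'
  rwa [(hF.zero_iff 0 hU.zero_mem).2 rfl]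

/-- For unbounded `U`, condition (D) confines `{F < y}` to a ball whose radius is polynomial in `y`.
-/
lemma SatisfiesABCD.exists_sublevelVolume_le (hF : SatisfiesABCD U F) :
    ∃ (C : ℝ) (N : ℕ), 0 ≤ C ∧ ∀ y : ℝ, 0 ≤ y →
      sublevelVolume U F y ≤ ENNReal.ofReal (C * (1 + y) ^ N) := by
  by_cases hb : Bornology.IsBounded U
  · refine ⟨(volume U).toReal, 0, ENNReal.toReal_nonneg, fun y _ => ?_⟩
    rw [pow_zero, mul_one, ENNReal.ofReal_toReal hb.measure_lt_top.ne]
    exact measure_mono fun z hz => hz.1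
  · obtain ⟨c, β, L, hc, hβ, hL, hgr⟩ := hF.growth hb
    set p : ℕ := ⌈1 / β⌉₊ with hp
    set d := Module.finrank ℝ (Fin n → ℂ) with hd
    set V : ENNReal := volume (Metric.ball (0 : Fin n → ℂ) 1) with hV
    have hVt : V ≠ ⊤ := measure_ball_lt_top.ne
    -- `L` covers the points where (D) gives nothing; the other term comes from `(y/c)^{1/β} ≤ ((1 +
    -- 1/c)(1 + y))^p`.
    set B : ℝ := L + (1 + 1 / c) ^ p with hB
    refine ⟨B ^ d * V.toReal, p * d, by positivity, fun y hy => ?_⟩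
    have hr0 : 0 ≤ B * (1 + y) ^ p := by positivity
    have hsub : {z | z ∈ U ∧ F z < y} ⊆ Metric.closedBall 0 (B * (1 + y) ^ p) := by
      intro z hz
      rw [mem_closedBall_zero_iff]
      refine (norm_le_euclNorm z).trans ?_
      have hone : 1 ≤ (1 + y) ^ p := one_le_pow₀ (by linarith)
      by_cases hzL : z ∈ euclBall ℂ n L
      · have h1 : euclNorm z < L := hzL
        have h2 : L ≤ B := by rw [hB]; linarith [(by positivity : 0 ≤ (1 + 1 / c) ^ p)]
        nlinarith
      · have h1 := (hgr z ⟨hz.1, hzL⟩).trans hz.2.le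
        have h2 : euclNorm z ^ β ≤ y / c := by
          rw [le_div_iff₀ hc]; linarith
        have h3 : euclNorm z ≤ (y / c) ^ (1 / β) := by
          rw [one_div, Real.le_rpow_inv_iff_of_pos (euclNorm_nonneg z) (by positivity) hβ]
          exact h2
        have h4 : (y / c) ^ (1 / β) ≤ (1 + y / c) ^ (1 / β) :=
          Real.rpow_le_rpow (by positivity) (by linarith) (by positivity)
        have h5 : (1 + y / c) ^ (1 / β) ≤ (1 + y / c) ^ p := by
          rw [← Real.rpow_natCast]
          exact Real.rpow_le_rpow_of_exponent_le (by
            have : 0 ≤ y / c := by positivity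
            linarith) (Nat.le_ceil _)
        have h6 : (1 + y / c) ^ p ≤ ((1 + 1 / c) * (1 + y)) ^ p := by
          gcongr
          have : (1 + 1 / c) * (1 + y) = 1 + y / c + (1 / c + y) := by ring
          rw [this]
          have : 0 ≤ 1 / c := by positivity
          linarith
        have h7 : ((1 + 1 / c) * (1 + y)) ^ p ≤ B * (1 + y) ^ p := by
          rw [mul_pow]
          gcongr
          rw [hB]
          linarith
        linarith
    refine (measure_mono hsub).trans (le_of_eq ?_)
    rw [Measure.addHaar_closedBall _ _ hr0, ← hd, ← hV, mul_pow, ← pow_mul,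
      ENNReal.ofReal_mul (by positivity), ENNReal.ofReal_mul (by positivity),
      ENNReal.ofReal_mul (by positivity), ENNReal.ofReal_toReal hVt]
    ring

/-- The weight of the half plane that belongs to `Ω_F`. -/
def sublevelWeight (U : Set (Fin n → ℂ)) (F : (Fin n → ℂ) → ℝ) : Measure ℝ :=
  volume.withDensity (sublevelVolume U F)

instance : SFinite (sublevelWeight U F) := by
  unfold sublevelWeight
  infer_instance

lemma measurable_sublevelVolume : Measurable (sublevelVolume U F) :=
  monotone_sublevelVolume.measurable

/-- The density is nondecreasing and positive on the positive axis, which gives `shift` and `lower`.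
Its polynomial growth of degree `N` gives `decay`, with exponent `N + 2` leaving an integrable `(1 +
y)⁻²`. -/
lemma SatisfiesABCD.isHalfPlaneWeight (hU : IsCompleteReinhardtDomain U)
    (hF : SatisfiesABCD U F) : IsHalfPlaneWeight (sublevelWeight U F) where
  null := by
    rw [sublevelWeight, withDensity_apply _ measurableSet_Iic,
      setLIntegral_congr_fun measurableSet_Iic (g := fun _ => 0)
        fun y hy => hF.sublevelVolume_eq_zero hU hy]
    simp
  decay := by
    obtain ⟨C, N, hC, hCN⟩ := hF.exists_sublevelVolume_le
    refine ⟨N + 2, by fun_prop, ?_⟩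
    rw [hasFiniteIntegral_iff_enorm, sublevelWeight,
      lintegral_withDensity_eq_lintegral_mul _ measurable_sublevelVolume (by fun_prop)]
    refine lt_of_le_of_lt (lintegral_mono fun y => ?_)
      (integrable_inv_one_add_sq.const_mul C).lintegral_lt_top
    rw [Pi.mul_apply]
    rcases le_or_gt y 0 with hy | hy
    · rw [hF.sublevelVolume_eq_zero hU hy, zero_mul]
      exact zero_le
    · rw [Real.enorm_of_nonneg (by positivity)]
      refine (mul_le_mul_left (hCN y hy.le) _).trans ?_
      rw [← ENNReal.ofReal_mul (by positivity)]
      refine ENNReal.ofReal_le_ofReal ?_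
      rw [mul_assoc]
      gcongr
      have h1 : (1 + y) ^ N * ((1 + y) ^ (N + 2))⁻¹ = ((1 + y) ^ 2)⁻¹ := by
        rw [pow_add]
        field_simp
      rw [h1]
      refine inv_anti₀ (by positivity) ?_
      nlinarith
  shift := by
    intro ε hε
    refine Measure.le_iff.2 fun s hs => ?_
    have hm : Measurable fun y : ℝ => y + ε := by fun_prop
    rw [Measure.map_apply hm hs, sublevelWeight, withDensity_apply _ (hm hs),
      withDensity_apply _ hs, ← lintegral_indicator (hm hs), ← lintegral_indicator hs,
      ← lintegral_add_right_eq_self (s.indicator fun y => sublevelVolume U F y) ε]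
    refine lintegral_mono fun y => ?_
    by_cases hy : y + ε ∈ s
    · rw [indicator_of_mem hy, indicator_of_mem (by exact hy)]
      exact monotone_sublevelVolume (by linarith)
    · rw [indicator_of_notMem (by exact hy)]
      exact zero_le
  lower := by
    intro a ha
    obtain ⟨C, N, hC, hCN⟩ := hF.exists_sublevelVolume_le
    refine ⟨sublevelVolume U F a, hF.sublevelVolume_ne_zero hU ha,
      ((hCN a ha.le).trans_lt ENNReal.ofReal_lt_top).ne, Measure.le_iff.2 fun s hs => ?_⟩
    rw [Measure.smul_apply, Measure.restrict_apply hs, smul_eq_mul, ← setLIntegral_const,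
      sublevelWeight, withDensity_apply _ hs]
    refine le_trans (setLIntegral_mono' (hs.inter measurableSet_Ioi) fun y hy =>
      monotone_sublevelVolume (U := U) (F := F) (le_of_lt hy.2)) ?_
    exact lintegral_mono_set inter_subset_left

end Model

/-! ### The Bergman kernel of the model domain -/

/-- The diagonal value of a Bergman kernel does not depend on the representative. -/
lemma IsBergmanKernelAt.bergmanKernel_self {E : Type*} [NormedAddCommGroup E] [NormedSpace ℂ E]
    [MeasureSpace E] {Ω : Set E} {w : E} {k : E → ℂ} (hk : IsBergmanKernelAt Ω w k) :
    bergmanKernel Ω w w = k w := by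
  have hex : ∃ k : E → ℂ, IsBergmanKernelAt Ω w k := ⟨k, hk⟩
  rw [bergmanKernel, dif_pos hex]
  set k' := hex.choose with hk'
  have hk'' : IsBergmanKernelAt Ω w k' := hex.choose_spec
  -- `k w = ⟨k, k⟩` is real. For the chosen representative, `k' w = ⟨k', k⟩` is the conjugate of `k
  -- w = ⟨k, k'⟩`.
  have h1 : (starRingEnd ℂ) (k w) = k w := by
    conv_lhs => rw [hk.2 k hk.1]
    conv_rhs => rw [hk.2 k hk.1]
    rw [← integral_conj]
    congr 1
    ext z
    rw [map_mul, conj_conj, mul_comm]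
  rw [← h1, hk.2 k' hk''.1, hk''.2 k hk.1, ← integral_conj]
  congr 1
  ext z
  rw [map_mul, conj_conj, mul_comm]

section Model

variable {n : ℕ} {U : Set (Fin n → ℂ)} {F : (Fin n → ℂ) → ℝ}

lemma SatisfiesABCD.isOpen_modelDomain (hU : IsCompleteReinhardtDomain U)
    (hF : SatisfiesABCD U F) : IsOpen (modelDomain U F) := by
  have hV : IsOpen {p : ℂ × (Fin n → ℂ) | p.2 ∈ U} := hU.isOpen.preimage continuous_snd
  have hc : ContinuousOn (fun p : ℂ × (Fin n → ℂ) => p.1.im - F p.2) {p | p.2 ∈ U} :=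
    (by fun_prop : Continuous fun p : ℂ × (Fin n → ℂ) => p.1.im).continuousOn.sub
      (hF.psh.1.comp continuousOn_snd fun p hp => hp)
  have := hc.isOpen_inter_preimage hV (isOpen_Ioi (a := 0))
  convert this using 1
  ext p
  simp [modelDomain]

lemma SatisfiesABCD.im_pos_of_mem (hU : IsCompleteReinhardtDomain U) (hF : SatisfiesABCD U F)
    {p : ℂ × (Fin n → ℂ)} (hp : p ∈ modelDomain U F) : 0 < p.1.im :=
  (hF.nonneg hU hp.1).trans_lt hp.2

/-- The slice of the model domain over `z₀` is `{F < Im z₀}`, whose volume is the density of the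
weight. Square integrals of functions of `z₀` alone therefore become weighted integrals over the
half plane. -/
lemma SatisfiesABCD.measurePreserving_re_im (hU : IsCompleteReinhardtDomain U)
    (hF : SatisfiesABCD U F) :
    MeasurePreserving (fun p : ℂ × (Fin n → ℂ) => (p.1.re, p.1.im))
      (volume.restrict (modelDomain U F)) (volume.prod (sublevelWeight U F)) := by
  have hm : Measurable (fun p : ℂ × (Fin n → ℂ) => (p.1.re, p.1.im)) := by fun_prop
  refine ⟨hm, Measure.ext fun s hs => ?_⟩
  have hO := (hF.isOpen_modelDomain hU).measurableSet
  rw [Measure.map_apply hm hs, Measure.restrict_apply (hm hs), Measure.volume_eq_prod,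
    Measure.prod_apply ((hm hs).inter hO), sublevelWeight,
    prod_withDensity_right measurable_sublevelVolume, withDensity_apply _ hs,
    ← lintegral_indicator hs]
  have hmi : Measurable (s.indicator fun q : ℝ × ℝ => sublevelVolume U F q.2) :=
    (measurable_sublevelVolume.comp measurable_snd).indicator hs
  rw [← Measure.volume_eq_prod, ← volume_preserving_equiv_real_prod.lintegral_comp hmi]
  refine lintegral_congr fun z₀ => ?_
  have e : measurableEquivRealProd z₀ = (z₀.re, z₀.im) := rfl
  rw [e]
  by_cases h : (z₀.re, z₀.im) ∈ s
  · rw [indicator_of_mem h, sublevelVolume]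
    congr 1
    ext z
    simp [modelDomain, h]
  · rw [indicator_of_notMem h]
    have : Prod.mk z₀ ⁻¹' ((fun p : ℂ × (Fin n → ℂ) => (p.1.re, p.1.im)) ⁻¹' s ∩
        modelDomain U F) = ∅ := by
      ext z
      simp [h]
    rw [this, measure_empty]

lemma measurePreserving_exp_smul_pi (θ : ℝ) :
    MeasurePreserving (fun z : Fin n → ℂ => cexp (θ * I) • z) volume volume :=
  volume_preserving_pi fun _ => measurePreserving_exp_smul θ

lemma norm_cexp_real_mul_I (θ : ℝ) : ‖cexp (θ * I)‖ = 1 := norm_exp_ofReal_mul_I θ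

lemma SatisfiesABCD.smul_mem_modelDomain (hU : IsCompleteReinhardtDomain U)
    (hF : SatisfiesABCD U F) {p : ℂ × (Fin n → ℂ)} (hp : p ∈ modelDomain U F) {ζ : ℂ}
    (hζ : ‖ζ‖ ≤ 1) : (p.1, ζ • p.2) ∈ modelDomain U F :=
  ⟨hU.smul_mem hp.1 hζ, (hF.apply_smul_le hU hp.1 hζ).trans_lt hp.2⟩

lemma SatisfiesABCD.measurePreserving_rotation (hU : IsCompleteReinhardtDomain U)
    (hF : SatisfiesABCD U F) (θ : ℝ) :
    MeasurePreserving (fun p : ℂ × (Fin n → ℂ) => (p.1, cexp (θ * I) • p.2))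
      (volume.restrict (modelDomain U F)) (volume.restrict (modelDomain U F)) := by
  have h := (MeasurePreserving.id (volume : Measure ℂ)).prod
    (measurePreserving_exp_smul_pi (n := n) θ)
  have h2 := h.restrict_preimage (hF.isOpen_modelDomain hU).measurableSet
  have e : Prod.map id (fun z : Fin n → ℂ => cexp (θ * I) • z) ⁻¹' modelDomain U F =
      modelDomain U F := by
    ext p
    constructor
    · intro hp
      have := hF.smul_mem_modelDomain hU hp (norm_cexp_real_mul_I (-θ)).le
      have e2 : cexp ((-θ : ℝ) * I) • cexp (θ * I) • p.2 = p.2 := by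
        rw [smul_smul, ← Complex.exp_add]
        simp
      simp only [Prod.map, id] at this
      rwa [e2] at this
    · intro hp
      exact hF.smul_mem_modelDomain hU hp (norm_cexp_real_mul_I θ).le
  rw [e] at h2
  exact h2

/-- The Bergman kernel of the model domain with pole `(iρ, 0)`. -/
theorem SatisfiesABCD.isBergmanKernelAt (hU : IsCompleteReinhardtDomain U)
    (hF : SatisfiesABCD U F) {ρ : ℝ} (hρ : 0 < ρ) :
    IsBergmanKernelAt (modelDomain U F) (I * ρ, 0)
      (fun p => halfPlaneKernel (sublevelWeight U F) (p.1 + ρ * I)) := by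
  set Λ := sublevelWeight U F with hΛdef
  have hΛ : IsHalfPlaneWeight Λ := hF.isHalfPlaneWeight hU
  have hO := (hF.isOpen_modelDomain hU)
  have hmp : MeasurePreserving (fun p : ℂ × (Fin n → ℂ) => (p.1.re, p.1.im))
      (volume.restrict (modelDomain U F)) (volume.prod Λ) := hF.measurePreserving_re_im hU
  have hkL : MemLp (fun p : ℂ × (Fin n → ℂ) => halfPlaneKernel Λ (p.1 + ρ * I)) 2
      (volume.restrict (modelDomain U F)) := by
    have := (hΛ.memLp_halfPlaneKernel hρ).comp_measurePreserving hmp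
    simpa [Function.comp_def, re_add_im] using this
  refine ⟨⟨?_, hkL⟩, fun f hf => ?_⟩
  · refine hΛ.differentiableOn_halfPlaneKernel.comp (by fun_prop) fun p hp => ?_
    have := hF.im_pos_of_mem hU hp
    simp
    linarith
  -- `g` is the rotational average of `f`: the disc `ζ ↦ (z₀, ζ • z)` stays in the domain because
  -- `F` does not increase under contraction, and its centre is `(z₀, 0)`.
  · set g : ℂ → ℂ := fun z₀ => f (z₀, 0) with hg
    have h0 : ∀ z₀ : ℂ, 0 < z₀.im → (z₀, (0 : Fin n → ℂ)) ∈ modelDomain U F := by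
      intro z₀ hz
      refine ⟨hU.zero_mem, ?_⟩
      simp only
      rwa [(hF.zero_iff 0 hU.zero_mem).2 rfl]
    have hgd : DifferentiableOn ℂ g {z | 0 < z.im} :=
      hf.1.comp (by fun_prop) fun z hz => h0 z hz
    have hT : Measurable (Function.uncurry fun (θ : ℝ) (p : ℂ × (Fin n → ℂ)) =>
        (p.1, cexp (θ * I) • p.2)) := by
      unfold Function.uncurry; fun_prop
    have hd : ∀ᵐ p ∂(volume.restrict (modelDomain U F)), ∃ h : ℂ → ℂ,
        DiffContOnCl ℂ h (Metric.ball 0 1) ∧ h 0 = g p.1 ∧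
          ∀ θ : ℝ, h (circleMap 0 1 θ) = f (p.1, cexp (θ * I) • p.2) := by
      refine (ae_restrict_iff' hO.measurableSet).2 (ae_of_all _ fun p hp => ?_)
      refine ⟨fun ζ => f (p.1, ζ • p.2), ?_, by simp [hg], fun θ => by simp [circleMap]⟩
      refine DifferentiableOn.diffContOnCl ?_
      rw [closure_ball _ one_ne_zero]
      refine hf.1.comp (by fun_prop) fun ζ hζ => ?_
      exact hF.smul_mem_modelDomain hU hp (by simpa using hζ)
    have hgO : AEStronglyMeasurable (fun p : ℂ × (Fin n → ℂ) => g p.1)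
        (volume.restrict (modelDomain U F)) := by
      refine ContinuousOn.aestronglyMeasurable ?_ hO.measurableSet
      exact hgd.continuousOn.comp continuousOn_fst fun p hp => hF.im_pos_of_mem hU hp
    have hsq := lintegral_center_sq_le hT (hF.measurePreserving_rotation hU) hf.2.1 hd
    have hgL : MemLp (fun p : ℂ × (Fin n → ℂ) => g p.1) 2
        (volume.restrict (modelDomain U F)) := by
      rw [memLp_two_iff_integrable_sq_norm hgO]
      refine ⟨hgO.norm.pow 2, ?_⟩
      rw [hasFiniteIntegral_iff_enorm]
      simp only [enorm_pow, enorm_norm]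
      refine hsq.trans_lt ?_
      have := ((memLp_two_iff_integrable_sq_norm hf.2.1).1 hf.2).2
      rw [hasFiniteIntegral_iff_enorm] at this
      simpa only [enorm_pow, enorm_norm] using this
    have hgm : AEStronglyMeasurable (fun q : ℝ × ℝ => g (q.1 + q.2 * I)) (volume.prod Λ) := by
      rw [← Measure.restrict_eq_self_of_ae_mem hΛ.ae_prod_pos]
      refine ContinuousOn.aestronglyMeasurable ?_
        (isOpen_lt continuous_const continuous_snd).measurableSet
      refine hgd.continuousOn.comp (by fun_prop) fun q hq => ?_
      have hq' : 0 < q.2 := hq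
      simpa using hq'
    have hgL2 : MemLp (fun q : ℝ × ℝ => g (q.1 + q.2 * I)) 2 (volume.prod Λ) := by
      have hgm' := hgm
      rw [← hmp.map_eq] at hgm' ⊢
      rw [memLp_map_measure_iff hgm' hmp.measurable.aemeasurable]
      simpa [Function.comp_def, re_add_im] using hgL
    have hrep := hΛ.integral_mul_conj_kernel hgd hgL2 hρ
    have hfk : Integrable (fun p => f p *
        (starRingEnd ℂ) (halfPlaneKernel Λ (p.1 + ρ * I))) (volume.restrict (modelDomain U F)) :=
      hf.2.integrable_mul hkL.star
    -- The kernel depends on `z₀` only, so it is constant on orbits and pairs equally with `f` and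
    -- with `g`.
    have hcen := integral_center_mul_eq (f := f) (f₀ := fun p => g p.1)
      (κ := fun p => (starRingEnd ℂ) (halfPlaneKernel Λ (p.1 + ρ * I))) hT
      (hF.measurePreserving_rotation hU) hfk (fun θ x => rfl) hd
    rw [← hcen]
    change g (I * ρ) = _
    rw [← hrep]
    have hkm : AEStronglyMeasurable (fun p : ℝ × ℝ => g (p.1 + p.2 * I) *
        (starRingEnd ℂ) (halfPlaneKernel Λ (p.1 + p.2 * I + ρ * I))) (volume.prod Λ) :=
      hgm.mul (continuous_conj.comp_aestronglyMeasurable (hΛ.memLp_halfPlaneKernel hρ).1)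
    rw [← hmp.map_eq] at hkm ⊢
    rw [integral_map hmp.measurable.aemeasurable hkm]
    simp only [re_add_im]

/-! ### The Laplace formula for the kernel on the vertical line. -/

/-- `c₀(τ)² = ∫_U e^{-2τF} dV`. -/
def cSq (U : Set (Fin n → ℂ)) (F : (Fin n → ℂ) → ℝ) (τ : ℝ) : ℝ :=
  ∫ z in U, Real.exp (-2 * τ * F z)

lemma SatisfiesABCD.aestronglyMeasurable_exp (hU : IsCompleteReinhardtDomain U)
    (hF : SatisfiesABCD U F) (τ : ℝ) :
    AEStronglyMeasurable (fun z => Real.exp (-2 * τ * F z)) (volume.restrict U) :=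
  ContinuousOn.aestronglyMeasurable
    (Real.continuous_exp.comp_continuousOn (continuousOn_const.mul hF.psh.1))
    hU.isOpen.measurableSet

/-- Tonelli on `{(y, z) : F z < y}`: at fixed `z`, integrating `e^{-2τy}` over `y > F z` gives
`e^{-2τF(z)} / (2τ)`. -/
lemma SatisfiesABCD.lintegral_exp_sublevelWeight (hU : IsCompleteReinhardtDomain U)
    (hF : SatisfiesABCD U F) {τ : ℝ} (hτ : 0 < τ) :
    ∫⁻ y, ENNReal.ofReal (Real.exp (-2 * τ * y)) ∂(sublevelWeight U F) =
      ∫⁻ z in U, ENNReal.ofReal ((2 * τ)⁻¹ * Real.exp (-2 * τ * F z)) := by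
  set O : Set (ℝ × (Fin n → ℂ)) := {p | p.2 ∈ U ∧ F p.2 < p.1} with hOdef
  have hO : IsOpen O := by
    have hV : IsOpen {p : ℝ × (Fin n → ℂ) | p.2 ∈ U} := hU.isOpen.preimage continuous_snd
    have hc : ContinuousOn (fun p : ℝ × (Fin n → ℂ) => p.1 - F p.2) {p | p.2 ∈ U} :=
      continuousOn_fst.sub (hF.psh.1.comp continuousOn_snd fun p hp => hp)
    have := hc.isOpen_inter_preimage hV (isOpen_Ioi (a := 0))
    convert this using 1
    ext p
    simp [hOdef]
  have hm : Measurable (Function.uncurry fun (y : ℝ) (z : Fin n → ℂ) =>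
      O.indicator (fun p => ENNReal.ofReal (Real.exp (-2 * τ * p.1))) (y, z)) := by
    have : Measurable fun p : ℝ × (Fin n → ℂ) => ENNReal.ofReal (Real.exp (-2 * τ * p.1)) := by
      fun_prop
    exact this.indicator hO.measurableSet
  have e1 : ∫⁻ y, ENNReal.ofReal (Real.exp (-2 * τ * y)) ∂(sublevelWeight U F) =
      ∫⁻ y, ∫⁻ z, O.indicator (fun p => ENNReal.ofReal (Real.exp (-2 * τ * p.1))) (y, z) := by
    rw [sublevelWeight, lintegral_withDensity_eq_lintegral_mul _ measurable_sublevelVolume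
      (by fun_prop)]
    refine lintegral_congr fun y => ?_
    have hs : MeasurableSet {z | z ∈ U ∧ F z < y} :=
      (hF.psh.1.isOpen_inter_preimage hU.isOpen isOpen_Iio).measurableSet
    have e : ∀ z, O.indicator (fun p => ENNReal.ofReal (Real.exp (-2 * τ * p.1))) (y, z) =
        {z | z ∈ U ∧ F z < y}.indicator (fun _ => ENNReal.ofReal (Real.exp (-2 * τ * y))) z := by
      intro z
      by_cases hz : z ∈ U ∧ F z < y
      · rw [indicator_of_mem (by exact hz), indicator_of_mem (by exact hz)]
      · rw [indicator_of_notMem (by exact hz), indicator_of_notMem (by exact hz)]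
    simp_rw [e]
    rw [lintegral_indicator hs, setLIntegral_const, Pi.mul_apply, mul_comm, sublevelVolume]
  rw [e1, lintegral_lintegral_swap hm.aemeasurable, ← lintegral_indicator hU.isOpen.measurableSet]
  refine lintegral_congr fun z => ?_
  by_cases hz : z ∈ U
  · rw [indicator_of_mem hz]
    have e : ∀ y : ℝ, O.indicator (fun p => ENNReal.ofReal (Real.exp (-2 * τ * p.1))) (y, z) =
        (Ioi (F z)).indicator (fun y => ENNReal.ofReal (Real.exp (-2 * τ * y))) y := by
      intro y
      by_cases hy : F z < y
      · rw [indicator_of_mem (by exact ⟨hz, hy⟩), indicator_of_mem (by exact hy)]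
      · rw [indicator_of_notMem (by exact fun h => hy h.2), indicator_of_notMem (by exact hy)]
    simp_rw [e]
    have hneg : -2 * τ < 0 := by linarith
    rw [lintegral_indicator measurableSet_Ioi, ← ofReal_integral_eq_lintegral_ofReal
      (integrableOn_exp_mul_Ioi hneg _) (ae_of_all _ fun y => (Real.exp_pos _).le),
      integral_exp_mul_Ioi hneg]
    congr 1
    field_simp
  · rw [indicator_of_notMem hz]
    have e : ∀ y : ℝ, O.indicator (fun p => ENNReal.ofReal (Real.exp (-2 * τ * p.1))) (y, z) = 0 :=
      fun y => indicator_of_notMem (by exact fun h => hz h.1) _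
    simp_rw [e]
    simp

lemma SatisfiesABCD.integrableOn_exp (hU : IsCompleteReinhardtDomain U)
    (hF : SatisfiesABCD U F) {τ : ℝ} (hτ : 0 < τ) :
    IntegrableOn (fun z => Real.exp (-2 * τ * F z)) U := by
  have h1 := ((hF.isHalfPlaneWeight hU).integrable_exp hτ).lintegral_lt_top
  rw [hF.lintegral_exp_sublevelWeight hU hτ] at h1
  have h2 : IntegrableOn (fun z => (2 * τ)⁻¹ * Real.exp (-2 * τ * F z)) U := by
    refine ⟨(hF.aestronglyMeasurable_exp hU τ).const_mul _, ?_⟩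
    rwa [hasFiniteIntegral_iff_ofReal (ae_of_all _ fun z => by positivity)]
  have h3 := h2.const_mul (2 * τ)
  refine h3.congr (ae_of_all _ fun z => ?_)
  simp only
  field_simp

lemma SatisfiesABCD.cSq_eq (hU : IsCompleteReinhardtDomain U) (hF : SatisfiesABCD U F) {τ : ℝ}
    (hτ : 0 < τ) : cSq U F τ = 2 * τ * weightLaplace (sublevelWeight U F) τ := by
  have h1 := hF.lintegral_exp_sublevelWeight hU hτ
  rw [← ofReal_integral_eq_lintegral_ofReal ((hF.isHalfPlaneWeight hU).integrable_exp hτ)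
    (ae_of_all _ fun y => (Real.exp_pos _).le),
    ← ofReal_integral_eq_lintegral_ofReal ((hF.integrableOn_exp hU hτ).const_mul _)
    (ae_of_all _ fun y => by positivity), integral_const_mul] at h1
  rw [ENNReal.ofReal_eq_ofReal_iff (integral_nonneg fun y => (Real.exp_pos _).le)
    (mul_nonneg (by positivity) (integral_nonneg fun y => (Real.exp_pos _).le))] at h1
  change weightLaplace (sublevelWeight U F) τ = (2 * τ)⁻¹ * cSq U F τ at h1
  rw [h1]
  field_simp

/-- The Laplace transform of the weight is `c₀(τ)² / (2τ)`, which turns the constant `1/(2π)` of the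
half plane kernel into `1/π` and supplies the factor `τ`. -/
theorem SatisfiesABCD.bergmanVertical_eq (hU : IsCompleteReinhardtDomain U)
    (hF : SatisfiesABCD U F) {ρ : ℝ} (hρ : 0 < ρ) :
    bergmanVertical U F ρ =
      1 / Real.pi * ∫ τ in Ioi (0 : ℝ), Real.exp (-2 * ρ * τ) * (τ / cSq U F τ) := by
  rw [bergmanVertical, (hF.isBergmanKernelAt hU hρ).bergmanKernel_self, halfPlaneKernel]
  have e : ∀ τ ∈ Ioi (0 : ℝ), cexp (I * (I * ρ + ρ * I) * τ) *
      ((weightLaplace (sublevelWeight U F) τ)⁻¹ : ℝ) =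
      ((2 * (Real.exp (-2 * ρ * τ) * (τ / cSq U F τ)) : ℝ) : ℂ) := by
    intro τ hτ
    have hτ0 : τ ≠ 0 := (ne_of_gt hτ)
    have e1 : I * (I * ρ + ρ * I) * τ = ((-2 * ρ * τ : ℝ) : ℂ) := by
      push_cast
      linear_combination (2 * (ρ : ℂ) * τ) * I_sq
    rw [e1, ← ofReal_exp, ← ofReal_mul, hF.cSq_eq hU hτ]
    congr 1
    have := ((hF.isHalfPlaneWeight hU).weightLaplace_pos hτ).ne'
    field_simp
  rw [setIntegral_congr_fun measurableSet_Ioi e, integral_complex_ofReal, integral_const_mul]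
  have e2 : (1 / (2 * (Real.pi : ℂ))) = ((1 / (2 * Real.pi) : ℝ) : ℂ) := by push_cast; rfl
  rw [e2, ← ofReal_mul, ofReal_re]
  field_simp

end Model

/-! ### Comparison with the localized integral -/

section Localized

variable {n : ℕ} {U : Set (Fin n → ℂ)} {F : (Fin n → ℂ) → ℝ} {R : ℝ} {φ : (Fin n → ℝ) → ℝ}

lemma SatisfiesABCD.measurable_integral_exp_mul (hU : IsCompleteReinhardtDomain U)
    (hF : SatisfiesABCD U F) {ψ : (Fin n → ℂ) → ℝ} (hψ : Measurable ψ) :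
    Measurable fun τ : ℝ => ∫ z in U, Real.exp (-2 * τ * F z) * ψ z := by
  -- `F` is controlled only on `U`; extension by zero makes it globally measurable without changing
  -- the integral.
  have hF' : Measurable (U.indicator F) := by
    classical
    exact hF.psh.1.measurable_piecewise continuousOn_const hU.isOpen.measurableSet
  have hm : Measurable (Function.uncurry fun (τ : ℝ) (z : Fin n → ℂ) =>
      Real.exp (-2 * τ * U.indicator F z) * ψ z) := by
    unfold Function.uncurry
    fun_prop
  have h := (hm.stronglyMeasurable.integral_prod_right (ν := volume.restrict U)).measurable
  have e : (fun τ : ℝ => ∫ z in U, Real.exp (-2 * τ * F z) * ψ z) =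
      fun τ => ∫ z in U, Real.exp (-2 * τ * U.indicator F z) * ψ z := by
    ext τ
    refine setIntegral_congr_fun hU.isOpen.measurableSet fun z hz => ?_
    simp only [indicator_of_mem hz]
  rwa [e]

lemma IsCutoff.continuous_polarLift (hφ : IsCutoff R φ) :
    Continuous (polarLift φ : (Fin n → ℂ) → ℝ) :=
  hφ.smooth.continuous.comp (by fun_prop)

lemma IsCutoff.polarLift_eq_one (hφ : IsCutoff R φ) {z : Fin n → ℂ}
    (hz : z ∈ euclBall ℂ n (R / 2)) : polarLift φ z = 1 := by
  refine hφ.eq_one _ ?_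
  change euclNorm _ < _
  have : euclNorm (fun j => ‖z j‖) = euclNorm z := by simp [euclNorm]
  rw [this]
  exact hz

lemma IsCutoff.polarLift_mem_Icc (hφ : IsCutoff R φ) (z : Fin n → ℂ) :
    polarLift φ z ∈ Icc (0 : ℝ) 1 := hφ.mem_Icc _

lemma SatisfiesABCD.integrableOn_exp_mul_polarLift (hU : IsCompleteReinhardtDomain U)
    (hF : SatisfiesABCD U F) (hφ : IsCutoff R φ) {τ : ℝ} (hτ : 0 < τ) :
    IntegrableOn (fun z => Real.exp (-2 * τ * F z) * polarLift φ z) U := by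
  refine (hF.integrableOn_exp hU hτ).mono' ((hF.aestronglyMeasurable_exp hU τ).mul
    hφ.continuous_polarLift.aestronglyMeasurable) (ae_of_all _ fun z => ?_)
  obtain ⟨h0, h1⟩ := hφ.polarLift_mem_Icc z
  rw [Real.norm_of_nonneg (by positivity)]
  exact mul_le_of_le_one_right (Real.exp_pos _).le h1

lemma SatisfiesABCD.cTildeSq_le_cSq (hU : IsCompleteReinhardtDomain U)
    (hF : SatisfiesABCD U F) (hφ : IsCutoff R φ) {τ : ℝ} (hτ : 0 < τ) :
    cTildeSq U F φ τ ≤ cSq U F τ := by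
  refine integral_mono (hF.integrableOn_exp_mul_polarLift hU hφ hτ) (hF.integrableOn_exp hU hτ)
    fun z => ?_
  exact mul_le_of_le_one_right (Real.exp_pos _).le (hφ.polarLift_mem_Icc z).2

/-- Near the origin `F < η/2` and the cut-off equals `1`, so the integrand exceeds `e^{-ητ}` on an
open set of positive volume. -/
lemma SatisfiesABCD.exists_le_cTildeSq (hU : IsCompleteReinhardtDomain U)
    (hF : SatisfiesABCD U F) (hR : 0 < R) (hRU : euclBall ℂ n R ⊆ U) (hφ : IsCutoff R φ)
    {η : ℝ} (hη : 0 < η) :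
    ∃ C : ℝ, 0 < C ∧ ∀ τ, 0 < τ → C * Real.exp (-η * τ) ≤ cTildeSq U F φ τ := by
  have hsub : euclBall ℂ n (R / 2) ⊆ U := fun z hz => hRU (by
    have : euclNorm z < R / 2 := hz
    change euclNorm z < R
    linarith)
  set W : Set (Fin n → ℂ) := euclBall ℂ n (R / 2) ∩ F ⁻¹' Iio (η / 2) with hW
  have hWo : IsOpen W := (hF.psh.1.mono hsub).isOpen_inter_preimage (isOpen_euclBall _) isOpen_Iio
  have hW0 : (0 : Fin n → ℂ) ∈ W := by
    constructor
    · change euclNorm _ < _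
      rw [euclNorm_zero]
      positivity
    · change F 0 < η / 2
      rw [(hF.zero_iff 0 hU.zero_mem).2 rfl]
      positivity
  have hWU : W ⊆ U := inter_subset_left.trans hsub
  have hWfin : volume W ≠ ⊤ := by
    refine ((measure_mono fun z hz => ?_).trans_lt
      (measure_closedBall_lt_top (x := (0 : Fin n → ℂ)) (r := R / 2))).ne
    rw [mem_closedBall_zero_iff]
    have : euclNorm z < R / 2 := hz.1
    exact (norm_le_euclNorm z).trans this.le
  have hWpos : 0 < (volume W).toReal :=
    ENNReal.toReal_pos (hWo.measure_pos volume ⟨0, hW0⟩).ne' hWfin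
  refine ⟨(volume W).toReal, hWpos, fun τ hτ => ?_⟩
  have hi := hF.integrableOn_exp_mul_polarLift hU hφ hτ
  have h1 : ∫ z in W, Real.exp (-η * τ) = (volume W).toReal * Real.exp (-η * τ) := by
    rw [setIntegral_const, smul_eq_mul, measureReal_def]
  rw [← h1]
  refine le_trans (setIntegral_mono_on (integrableOn_const hWfin) (hi.mono_set hWU)
    hWo.measurableSet fun z hz => ?_) (setIntegral_mono_set hi (ae_of_all _ fun z => ?_)
      hWU.eventuallyLE)
  · rw [hφ.polarLift_eq_one hz.1, mul_one]
    refine Real.exp_le_exp.2 ?_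
    have : F z < η / 2 := hz.2
    nlinarith
  · exact mul_nonneg (Real.exp_pos _).le (hφ.polarLift_mem_Icc z).1

/-- The difference lives where `F ≥ m`. Only `e^{-2(τ-1)F}` is estimated by its supremum there; the
remaining `e^{-2F}` keeps the integral finite on unbounded `U`. -/
lemma SatisfiesABCD.exists_cSq_sub_cTildeSq_le (hU : IsCompleteReinhardtDomain U)
    (hF : SatisfiesABCD U F) (hR : 0 < R) (hRU : euclBall ℂ n R ⊆ U) (hφ : IsCutoff R φ) :
    ∃ m : ℝ, 0 < m ∧ ∀ τ, 1 ≤ τ →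
      cSq U F τ - cTildeSq U F φ τ ≤ cSq U F 1 * Real.exp (-2 * m * (τ - 1)) := by
  obtain ⟨m, hm, hmF⟩ := hF.exists_pos_le hU (half_pos hR) (half_lt_self hR) hRU
  refine ⟨m, hm, fun τ hτ => ?_⟩
  have hτ0 : 0 < τ := by linarith
  have i1 := hF.integrableOn_exp hU hτ0
  have i2 := hF.integrableOn_exp_mul_polarLift hU hφ hτ0
  have i3 := hF.integrableOn_exp hU one_pos
  rw [cSq, cTildeSq, ← integral_sub i1 i2, cSq, ← integral_mul_const]
  refine setIntegral_mono_on (i1.sub i2) (i3.mul_const _) hU.isOpen.measurableSet fun z hz => ?_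
  obtain ⟨h0, h1⟩ := hφ.polarLift_mem_Icc z
  by_cases hzR : z ∈ euclBall ℂ n (R / 2)
  · rw [hφ.polarLift_eq_one hzR, mul_one, sub_self]
    positivity
  · have h2 := hmF z hz hzR
    calc Real.exp (-2 * τ * F z) - Real.exp (-2 * τ * F z) * polarLift φ z
        ≤ Real.exp (-2 * τ * F z) := by
          have := mul_nonneg (Real.exp_pos (-2 * τ * F z)).le h0
          linarith
      _ ≤ Real.exp (-2 * 1 * F z + -2 * m * (τ - 1)) := by
          refine Real.exp_le_exp.2 ?_
          nlinarith
      _ = _ := Real.exp_add _ _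

lemma le_exp_mul_div {s τ : ℝ} (hs : 0 < s) : τ ≤ Real.exp (s * τ) / s := by
  rw [le_div_iff₀ hs]
  linarith [Real.add_one_le_exp (s * τ)]

lemma SatisfiesABCD.integrableOn_localized (hU : IsCompleteReinhardtDomain U)
    (hF : SatisfiesABCD U F) (hR : 0 < R) (hRU : euclBall ℂ n R ⊆ U) (hφ : IsCutoff R φ)
    {ρ : ℝ} (hρ : 0 < ρ) :
    IntegrableOn (fun τ : ℝ => Real.exp (-2 * ρ * τ) * (τ / cTildeSq U F φ τ)) (Ioi 0) := by
  -- Of the decay `e^{-2ρτ}`, the denominator uses `ρ/2` and the factor `τ` another `ρ/2`, leaving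
  -- `e^{-ρτ}`.
  obtain ⟨C, hC, hCle⟩ := hF.exists_le_cTildeSq hU hR hRU hφ (half_pos hρ)
  have hmeas : Measurable (cTildeSq U F φ) :=
    hF.measurable_integral_exp_mul hU hφ.continuous_polarLift.measurable
  have hdom : IntegrableOn (fun τ => 2 / (ρ * C) * Real.exp (-ρ * τ)) (Ioi 0) :=
    (integrableOn_exp_mul_Ioi (by linarith) 0).const_mul _
  refine hdom.mono' (by
    have : Measurable fun τ : ℝ => Real.exp (-2 * ρ * τ) * (τ / cTildeSq U F φ τ) := by fun_prop
    exact this.aestronglyMeasurable) ?_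
  refine (ae_restrict_iff' measurableSet_Ioi).2 (ae_of_all _ fun τ hτ => ?_)
  have hτ0 : 0 < τ := hτ
  have h1 := hCle τ hτ
  have h2 : 0 < C * Real.exp (-(ρ / 2) * τ) := by positivity
  have h3 : 0 < cTildeSq U F φ τ := h2.trans_le h1
  rw [Real.norm_of_nonneg (by positivity)]
  calc Real.exp (-2 * ρ * τ) * (τ / cTildeSq U F φ τ)
      ≤ Real.exp (-2 * ρ * τ) * (Real.exp (ρ / 2 * τ) / (ρ / 2) /
        (C * Real.exp (-(ρ / 2) * τ))) := by
        gcongr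
        exact le_exp_mul_div (half_pos hρ)
    _ = 2 / (ρ * C) * (Real.exp (-2 * ρ * τ) * Real.exp (ρ / 2 * τ) *
        (Real.exp (-(ρ / 2) * τ))⁻¹) := by field_simp
    _ = 2 / (ρ * C) * Real.exp (-ρ * τ) := by
        rw [← Real.exp_neg, ← Real.exp_add, ← Real.exp_add]
        congr 2
        ring

/-- For `τ ≥ 1` the numerator gains `e^{-2mτ}`, the two denominators lose `e^{mτ/4}` each and the
factor `τ` loses `e^{mτ/2}`, so `e^{-mτ}` survives. For `τ < 1` boundedness is enough. -/
lemma SatisfiesABCD.exists_difference_le (hU : IsCompleteReinhardtDomain U)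
    (hF : SatisfiesABCD U F) (hR : 0 < R) (hRU : euclBall ℂ n R ⊆ U) (hφ : IsCutoff R φ) :
    ∃ m D : ℝ, 0 < m ∧ ∀ τ, 0 < τ →
      τ / cTildeSq U F φ τ - τ / cSq U F τ ≤ D * Real.exp (-m * τ) := by
  obtain ⟨m, hm, hmle⟩ := hF.exists_cSq_sub_cTildeSq_le hU hR hRU hφ
  obtain ⟨C, hC, hCle⟩ := hF.exists_le_cTildeSq hU hR hRU hφ (η := m / 4) (by positivity)
  set c₁ := cSq U F 1 with hc₁
  have hc₁0 : 0 ≤ c₁ := integral_nonneg fun z => (Real.exp_pos _).le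
  refine ⟨m, max (c₁ * Real.exp (2 * m) / C ^ 2 * (2 / m)) (Real.exp (m / 4 + m) / C), hm,
    fun τ hτ => ?_⟩
  have h1 := hCle τ hτ
  have h2 : 0 < C * Real.exp (-(m / 4) * τ) := by positivity
  have h3 : 0 < cTildeSq U F φ τ := h2.trans_le h1
  have h4 := hF.cTildeSq_le_cSq hU hφ hτ
  have h5 : 0 < cSq U F τ := h3.trans_le h4
  rcases le_or_gt 1 τ with hτ1 | hτ1
  · have h6 := hmle τ hτ1
    calc τ / cTildeSq U F φ τ - τ / cSq U F τ
        = τ * ((cSq U F τ - cTildeSq U F φ τ) / (cTildeSq U F φ τ * cSq U F τ)) := by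
          field_simp
      _ ≤ Real.exp (m / 2 * τ) / (m / 2) * (c₁ * Real.exp (-2 * m * (τ - 1)) /
          (C * Real.exp (-(m / 4) * τ) * (C * Real.exp (-(m / 4) * τ)))) := by
          gcongr
          · exact le_exp_mul_div (half_pos hm)
          · exact h1.trans h4
      _ = c₁ / C ^ 2 * (2 / m) * (Real.exp (m / 2 * τ) * Real.exp (-2 * m * (τ - 1)) *
          (Real.exp (-(m / 4) * τ))⁻¹ * (Real.exp (-(m / 4) * τ))⁻¹) := by field_simp
      _ = c₁ * Real.exp (2 * m) / C ^ 2 * (2 / m) * Real.exp (-m * τ) := by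
          have : Real.exp (m / 2 * τ) * Real.exp (-2 * m * (τ - 1)) *
              (Real.exp (-(m / 4) * τ))⁻¹ * (Real.exp (-(m / 4) * τ))⁻¹ =
              Real.exp (2 * m) * Real.exp (-m * τ) := by
            rw [← Real.exp_neg, ← Real.exp_add, ← Real.exp_add, ← Real.exp_add, ← Real.exp_add]
            congr 1
            ring
          rw [this]
          ring
      _ ≤ _ := by
          gcongr
          exact le_max_left _ _
  · calc τ / cTildeSq U F φ τ - τ / cSq U F τ ≤ τ / cTildeSq U F φ τ := by
          have : 0 ≤ τ / cSq U F τ := by positivity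
          linarith
      _ ≤ 1 / (C * Real.exp (-(m / 4) * τ)) := by gcongr
      _ = 1 / C * Real.exp (m / 4 * τ) := by
          rw [neg_mul, Real.exp_neg]
          field_simp
      _ ≤ 1 / C * Real.exp (m / 4 + m + -m * τ) := by
          gcongr
          nlinarith
      _ = Real.exp (m / 4 + m) / C * Real.exp (-m * τ) := by
          rw [Real.exp_add]
          ring
      _ ≤ _ := by
          gcongr
          exact le_max_right _ _

end Localized

end BergmanModel

end

theorem proposition1 {n : ℕ} (U : Set (Fin n → ℂ))
    (hU : BergmanModel.IsCompleteReinhardtDomain U) (hUpsc : BergmanModel.IsPseudoconvex U)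
    (F : (Fin n → ℂ) → ℝ) (hFsmooth : ContDiffOn ℝ ∞ F U)
    (hF : BergmanModel.SatisfiesABCD U F)
    (R : ℝ) (hR : 0 < R) (hRU : BergmanModel.euclBall ℂ n R ⊆ U)
    (φ : (Fin n → ℝ) → ℝ) (hφ : BergmanModel.IsCutoff R φ) :
    -- the integrals and the kernel involved are well defined (no junk values)
    (∀ τ : ℝ, 0 < τ → 0 < BergmanModel.cTildeSq U F φ τ) ∧
    (∀ ρ : ℝ, 0 < ρ →
      IntegrableOn (fun τ : ℝ => Real.exp (-2 * ρ * τ) * (τ / BergmanModel.cTildeSq U F φ τ))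
        (Ioi 0)) ∧
    (∀ ρ : ℝ, 0 < ρ → ∃ k : ℂ × (Fin n → ℂ) → ℂ,
      BergmanModel.IsBergmanKernelAt (BergmanModel.modelDomain U F) (Complex.I * ρ, 0) k) ∧
    -- the difference extends real-analytically across `ρ = 0`
    ∃ δ : ℝ, 0 < δ ∧ ∃ g : ℝ → ℝ, AnalyticOnNhd ℝ g (Ioi (-δ)) ∧
      ∀ ρ : ℝ, 0 < ρ →
        g ρ = BergmanModel.localizedBergman U F φ ρ - BergmanModel.bergmanVertical U F ρ := by
  have hpos : ∀ τ : ℝ, 0 < τ → 0 < BergmanModel.cTildeSq U F φ τ := by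
    obtain ⟨C, hC, hCle⟩ := hF.exists_le_cTildeSq hU hR hRU hφ one_pos
    exact fun τ hτ => (by positivity : 0 < C * Real.exp (-1 * τ)).trans_le (hCle τ hτ)
  have h_int := fun (ρ : ℝ) (hρ : 0 < ρ) => hF.integrableOn_localized hU hR hRU hφ hρ
  refine ⟨hpos, h_int, fun ρ hρ => ⟨_, hF.isBergmanKernelAt hU hρ⟩, ?_⟩
  obtain ⟨m, D, hm, hD⟩ := hF.exists_difference_le hU hR hRU hφ
  have hle := fun (τ : ℝ) (hτ : 0 < τ) => hF.cTildeSq_le_cSq hU hφ hτ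
  have hct : Measurable (BergmanModel.cTildeSq U F φ) :=
    hF.measurable_integral_exp_mul hU hφ.continuous_polarLift.measurable
  have hcm : Measurable (BergmanModel.cSq U F) := by
    have := hF.measurable_integral_exp_mul hU (measurable_const (a := (1 : ℝ)))
    simp only [mul_one] at this
    exact this
  set w : ℝ → ℝ := fun τ =>
    τ / BergmanModel.cTildeSq U F φ τ - τ / BergmanModel.cSq U F τ with hw
  have hwm : Measurable w := by fun_prop
  have hw0 : ∀ τ, 0 < τ → 0 ≤ w τ := fun τ hτ =>
    sub_nonneg.2 (div_le_div_of_nonneg_left hτ.le (hpos τ hτ) (hle τ hτ))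
  -- Exponential decay of `w` extends convergence of its Laplace transform to negative `t`, beyond
  -- the range of either integral guaranteed above.
  have hwi : ∀ t, -m < t → IntegrableOn (fun τ => Real.exp (-t * τ) * w τ) (Ioi 0) := by
    intro t ht
    have hdom : IntegrableOn (fun τ => D * Real.exp (-(t + m) * τ)) (Ioi 0) :=
      (integrableOn_exp_mul_Ioi (by linarith) 0).const_mul _
    refine hdom.mono' (by fun_prop) ?_
    refine (ae_restrict_iff' measurableSet_Ioi).2 (ae_of_all _ fun τ hτ => ?_)
    rw [Real.norm_of_nonneg (mul_nonneg (Real.exp_pos _).le (hw0 τ hτ))]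
    calc Real.exp (-t * τ) * w τ ≤ Real.exp (-t * τ) * (D * Real.exp (-m * τ)) := by
          gcongr
          exact hD τ hτ
      _ = D * (Real.exp (-t * τ) * Real.exp (-m * τ)) := by ring
      _ = D * Real.exp (-(t + m) * τ) := by
          rw [← Real.exp_add]
          congr 2
          ring
  have hana := BergmanModel.analyticOnNhd_laplace hwm hw0 hwi
  -- The Laplace variable is `t = 2ρ`, so `t > -m` becomes `ρ > -m/2`.
  refine ⟨m / 2, half_pos hm, fun ρ => 1 / Real.pi *
    ∫ τ in Ioi 0, Real.exp (-(2 * ρ) * τ) * w τ, ?_, fun ρ hρ => ?_⟩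
  · intro ρ hρ
    have h1 : -m < 2 * ρ := by
      have : -(m / 2) < ρ := hρ
      linarith
    have h2 : AnalyticAt ℝ (fun ρ : ℝ => 2 * ρ) ρ := by fun_prop
    have h3 := AnalyticAt.comp_of_eq (hana (2 * ρ) h1) h2 rfl
    exact analyticAt_const.mul h3
  · have hi1 := h_int ρ hρ
    -- Since `c̃₀² ≤ c₀²`, the integrand of the kernel is dominated by the localized one.
    have hi2 : IntegrableOn (fun τ : ℝ =>
        Real.exp (-2 * ρ * τ) * (τ / BergmanModel.cSq U F τ)) (Ioi 0) := by
      refine hi1.mono' (by fun_prop) ?_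
      refine (ae_restrict_iff' measurableSet_Ioi).2 (ae_of_all _ fun τ hτ => ?_)
      have hτ0 : (0 : ℝ) < τ := hτ
      have h1 := hpos τ hτ
      have h2 := hle τ hτ
      have h3 := h1.trans_le h2
      rw [Real.norm_of_nonneg (by positivity)]
      gcongr
    rw [BergmanModel.localizedBergman, hF.bergmanVertical_eq hU hρ, ← mul_sub,
      ← integral_sub hi1 hi2]
    refine congrArg (1 / Real.pi * ·) (integral_congr_ae (ae_of_all _ fun τ => ?_))
    simp only [hw]
    rw [← mul_sub, neg_mul, neg_mul, neg_mul]
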